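/- Let $n\ge 4$ and let $f\colon M^n\to\mathbb{S}^{n+1}$ be a smooth isometric immersion of a compact oriented $n$-dimensional Riemannian manifold (without boundary) into the unit sphere of $\mathbb{R}^{n+2}$ (the orientation is not actually needed). Let $H\ge 0$ denote the length of the mean curvature vector $\frac1n\operatorname{tr}\alpha$, where $\alpha$ is the second fundamental form of $f$. Let $k$ be an integer with $2\le k\le n/2$, and assume that at every point of $M^n$ the (not normalized) Ricci curvature satisfies $$ \mathrm{Ric}_M(X)\ \ge\ b(n,k,H):=\frac{n(k-1)}{k}+\frac{n(k-1)H}{2k^2}\Big(nH+\sqrt{n^2H^2+4k(n-k)}\Big) $$ for all unit tangent vectors $X$. Let $\mathcal{B}^{[k]}$ be the Bochner operator on $k$-forms, that is, the operator defined by the Bochner–Weitzenböck decomposition $$ \Delta\omega=\nabla^*\nabla\omega+\mathcal{B}^{[k]}\omega ,\qquad \omega\in\Omega^k(M^n), $$ where $\Delta=d\delta+\delta d$ is the Hodge–Laplace operator and $\nabla^*\nabla=-\operatorname{tr}\nabla^2$ is the connection Laplacian of the Levi-Civita connection. Then $\mathcal{B}^{[k]}$ is nonnegative: $\langle\mathcal{B}^{[k]}\omega,\omega\rangle\ge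 0$ at every point of $M^n$, for every smooth $k$-form $\omega$. -/

import Mathlib

open scoped Manifold ContDiff RealInnerProductSpace

noncomputable section

namespace HypersurfaceBochner

/-! ### Metric algebra in a frame

`b : Fin n → V` is a frame (basis) of a vector space `V`, and `B` is the inner product of `V`. -/

/-- The inverse `(g^{ij})` of the Gram matrix `g_{ij} = B (b i) (b j)`. -/
def invGram {V : Type*} {n : ℕ} (b : Fin n → V) (B : V → V → ℝ) : Matrix (Fin n) (Fin n) ℝ :=
  (Matrix.of fun i j => B (b i) (b j))⁻¹

/-- The natural inner product of alternating `k`-forms,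
`⟨α, β⟩ = (1/k!) g^{i₁j₁} ⋯ g^{iₖjₖ} α_{i₁…iₖ} β_{j₁…jₖ}`. It does not depend on the frame `b`;
if `b` is orthonormal with dual frame `θ`, the forms `θ_{i₁} ∧ ⋯ ∧ θ_{iₖ}`, `i₁ < ⋯ < iₖ`,
are orthonormal. -/
def formInner {V : Type*} {n k : ℕ} (b : Fin n → V) (B : V → V → ℝ)
    (α β : (Fin k → V) → ℝ) : ℝ :=
  ((k.factorial : ℝ))⁻¹ * ∑ I : Fin k → Fin n, ∑ J : Fin k → Fin n,
    (∏ s, invGram b B (I s) (J s)) * α (fun s => b (I s)) * β (fun s => b (J s))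

/-! ### Riemannian geometry in a coordinate domain

A metric, or a covariant `k`-tensor field, on (an open part of) `ℝⁿ` is given by its values on
vectors. The constant vector fields `e n i` are the coordinate fields. -/

/-- The `i`-th coordinate vector of `ℝⁿ`. -/
def e (n : ℕ) (i : Fin n) : EuclideanSpace ℝ (Fin n) := EuclideanSpace.single i 1

/-- A field of bilinear forms on a domain of `ℝⁿ`, `G y u v`. -/
abbrev MetricField (n : ℕ) : Type :=
  EuclideanSpace ℝ (Fin n) → EuclideanSpace ℝ (Fin n) → EuclideanSpace ℝ (Fin n) → ℝ

/-- A covariant `k`-tensor field on a domain of `ℝⁿ`, `T y (v₁, …, vₖ)`. -/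
abbrev TensorField (n k : ℕ) : Type :=
  EuclideanSpace ℝ (Fin n) → (Fin k → EuclideanSpace ℝ (Fin n)) → ℝ

namespace Coord

variable {n : ℕ}

/-- The matrix `g^{ij}` at `y`. -/
def inv (G : MetricField n) (y : EuclideanSpace ℝ (Fin n)) : Matrix (Fin n) (Fin n) ℝ :=
  invGram (e n) (G y)

/-- The Levi-Civita connection on constant vector fields: `∇_u v = Γ(u, v)` with
`Γ(u, v)^i = ½ g^{il} (∂_u g(v, e_l) + ∂_v g(u, e_l) - ∂_l g(u, v))`. -/
def christoffel (G : MetricField n) (y u v : EuclideanSpace ℝ (Fin n)) :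
    EuclideanSpace ℝ (Fin n) :=
  ∑ i, (∑ l, inv G y i l * ((1 / 2 : ℝ) *
    (fderiv ℝ (fun z => G z v (e n l)) y u + fderiv ℝ (fun z => G z u (e n l)) y v
      - fderiv ℝ (fun z => G z u v) y (e n l)))) • e n i

/-- The curvature `R(u, v) w = ∇_u ∇_v w - ∇_v ∇_u w` for constant vector fields `u, v, w`. -/
def curvature (G : MetricField n) (y u v w : EuclideanSpace ℝ (Fin n)) :
    EuclideanSpace ℝ (Fin n) :=
  fderiv ℝ (fun z => christoffel G z v w) y u + christoffel G y u (christoffel G y v w)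
    - (fderiv ℝ (fun z => christoffel G z u w) y v + christoffel G y v (christoffel G y u w))

/-- The Ricci tensor `Ric(v, w) = tr (u ↦ R(u, v) w)`. -/
def ricci (G : MetricField n) (y v w : EuclideanSpace ℝ (Fin n)) : ℝ :=
  ∑ i, (curvature G y (e n i) v w) i

/-- The covariant derivative of a covariant tensor field,
`(∇T)(v₀, v₁, …, vₖ) = (∇_{v₀} T)(v₁, …, vₖ)
  = ∂_{v₀} (T(v₁, …, vₖ)) - ∑ s, T(v₁, …, Γ(v₀, v_s), …, vₖ)`. -/
def covDeriv (G : MetricField n) {k : ℕ} (T : TensorField n k) : TensorField n (k + 1) :=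
  fun y v => fderiv ℝ (fun z => T z (Fin.tail v)) y (v 0)
    - ∑ s, T y (Function.update (Fin.tail v) s (christoffel G y (v 0) (Fin.tail v s)))

/-- The metric trace in the first two arguments of a `(k + 2)`-tensor field. -/
def traceFirstTwo (G : MetricField n) {k : ℕ} (T : TensorField n (k + 2)) : TensorField n k :=
  fun y v => ∑ i, ∑ j, inv G y i j *
    T y (Fin.cons (e n i) (Fin.cons (e n j) v : Fin (k + 1) → EuclideanSpace ℝ (Fin n)))

/-- The exterior derivative of a `k`-form,
`dη(v₀, …, vₖ) = ∑ i, (-1)^i ∂_{v_i} (η(v₀, …, v̂_i, …, vₖ))` for constant `v₀, …, vₖ`. -/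
def extD {k : ℕ} (T : TensorField n k) : TensorField n (k + 1) :=
  fun y v => ∑ i : Fin (k + 1),
    (-1 : ℝ) ^ (i : ℕ) * fderiv ℝ (fun z => T z (fun s => v (i.succAbove s))) y (v i)

/-- The co-differential `δη = -tr ∇η`, that is `-∑ i, (∇_{E_i} η)(E_i, ·, …, ·)` for an
orthonormal frame `E_i`. -/
def codiff (G : MetricField n) {k : ℕ} (T : TensorField n (k + 1)) : TensorField n k :=
  fun y v => -traceFirstTwo G (covDeriv G T) y v

/-- The Hodge Laplacian `Δ = dδ + δd` on `k`-forms (with `δ = 0` on functions). -/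
def hodgeLaplacian (G : MetricField n) : (k : ℕ) → TensorField n k → TensorField n k
  | 0, T => codiff G (extD T)
  | _ + 1, T => fun y v => extD (codiff G T) y v + codiff G (extD T) y v

/-- The rough (connection) Laplacian `∇*∇T = -tr ∇²T`. -/
def roughLaplacian (G : MetricField n) {k : ℕ} (T : TensorField n k) : TensorField n k :=
  fun y v => -traceFirstTwo G (covDeriv G (covDeriv G T)) y v

end Coord

/-! ### Riemannian manifolds

All objects at a point `x` are computed in the preferred chart at `x`. -/

variable {n : ℕ} {M : Type*} [TopologicalSpace M] [ChartedSpace (EuclideanSpace ℝ (Fin n)) M]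

/-- The coordinate frame of `T_x M` of the preferred chart at `x`: Mathlib identifies `T_x M`
with the model space `ℝⁿ` by means of that chart. -/
def coordFrame (x : M) (i : Fin n) : TangentSpace (𝓡 n) x := e n i

/-- The differential at `x` of the preferred chart at `x`. -/
def chartDeriv (x : M) : TangentSpace (𝓡 n) x →L[ℝ] EuclideanSpace ℝ (Fin n) :=
  mfderiv (𝓡 n) 𝓘(ℝ, EuclideanSpace ℝ (Fin n)) (extChartAt (𝓡 n) x) x

/-- The differential at `y ∈ ℝⁿ` of the inverse of the preferred chart at `x`. -/
def chartSymmDeriv (x : M) (y : EuclideanSpace ℝ (Fin n)) :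
    EuclideanSpace ℝ (Fin n) →L[ℝ] TangentSpace (𝓡 n) ((extChartAt (𝓡 n) x).symm y) :=
  mfderiv 𝓘(ℝ, EuclideanSpace ℝ (Fin n)) (𝓡 n) (extChartAt (𝓡 n) x).symm y

/-- A (not necessarily smooth) differential `k`-form on `M`: an element of `Λᵏ T_x^* M`
at every point `x`. -/
abbrev DiffForm (n : ℕ) (M : Type*) [TopologicalSpace M]
    [ChartedSpace (EuclideanSpace ℝ (Fin n)) M] (k : ℕ) : Type _ :=
  (x : M) → (TangentSpace (𝓡 n) x) [⋀^Fin k]→ₗ[ℝ] ℝ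

/-- The expression of a differential form in the preferred chart at `x`: its pullback by the
inverse of that chart. -/
def chartForm {k : ℕ} (η : DiffForm n M k) (x : M) : TensorField n k :=
  fun y v => η ((extChartAt (𝓡 n) x).symm y) (fun s => chartSymmDeriv x y (v s))

/-- `η ∈ Ωᵏ(M)`: all components of `η` in the charts are smooth. -/
def IsSmoothForm {k : ℕ} (η : DiffForm n M k) : Prop :=
  ∀ (x : M) (v : Fin k → EuclideanSpace ℝ (Fin n)),
    ContDiffOn ℝ ∞ (fun y => chartForm η x y v) (extChartAt (𝓡 n) x).target

variable [IsManifold (𝓡 n) ∞ M]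

/-- Smooth Riemannian metrics on `M`. -/
abbrev RiemMetric (n : ℕ) (M : Type*) [TopologicalSpace M]
    [ChartedSpace (EuclideanSpace ℝ (Fin n)) M] [IsManifold (𝓡 n) ∞ M] : Type _ :=
  letI : IsManifold (𝓡 n) 1 M := IsManifold.of_le (n := ∞) (by simp)
  Bundle.ContMDiffRiemannianMetric (𝓡 n) ∞ (EuclideanSpace ℝ (Fin n))
    (fun x : M => TangentSpace (𝓡 n) x)

/-- The inner product of `T_x M`. -/
def RiemMetric.at (g : RiemMetric n M) (x : M) (X Y : TangentSpace (𝓡 n) x) : ℝ :=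
  g.inner x X Y

/-- The metric in the preferred chart at `x`. -/
def chartMetric (g : RiemMetric n M) (x : M) : MetricField n :=
  fun y u v => RiemMetric.at g ((extChartAt (𝓡 n) x).symm y)
    (chartSymmDeriv x y u) (chartSymmDeriv x y v)

/-- The (not normalized) Ricci tensor of `(M, g)`. -/
def ricciTensor (g : RiemMetric n M) (x : M) (X Y : TangentSpace (𝓡 n) x) : ℝ :=
  Coord.ricci (chartMetric g x) (extChartAt (𝓡 n) x x) (chartDeriv x X) (chartDeriv x Y)

/-- The Hodge Laplacian `Δη = dδη + δdη` at `x`, on tangent vectors `X₁, …, Xₖ`. -/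
def hodgeLaplacian (g : RiemMetric n M) {k : ℕ} (η : DiffForm n M k) (x : M)
    (X : Fin k → TangentSpace (𝓡 n) x) : ℝ :=
  Coord.hodgeLaplacian (chartMetric g x) k (chartForm η x) (extChartAt (𝓡 n) x x)
    (fun s => chartDeriv x (X s))

/-- The connection Laplacian `∇*∇η` at `x`, on tangent vectors `X₁, …, Xₖ`. -/
def roughLaplacian (g : RiemMetric n M) {k : ℕ} (η : DiffForm n M k) (x : M)
    (X : Fin k → TangentSpace (𝓡 n) x) : ℝ :=
  Coord.roughLaplacian (chartMetric g x) (chartForm η x) (extChartAt (𝓡 n) x x)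
    (fun s => chartDeriv x (X s))

/-- The Bochner operator on `k`-forms, defined by the Bochner-Weitzenböck decomposition
`Δη = ∇*∇η + 𝓑η` of the Hodge Laplacian. -/
def bochnerOperator (g : RiemMetric n M) {k : ℕ} (η : DiffForm n M k) (x : M)
    (X : Fin k → TangentSpace (𝓡 n) x) : ℝ :=
  hodgeLaplacian g η x X - roughLaplacian g η x X

/-- The Bochner operator `𝓑` on `k`-forms is nonnegative: `⟨𝓑η, η⟩ ≥ 0` at every point, for every
smooth `k`-form `η`. -/
def BochnerNonneg (g : RiemMetric n M) (k : ℕ) : Prop :=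
  ∀ η : DiffForm n M k, IsSmoothForm η → ∀ x : M,
    0 ≤ formInner (coordFrame x) (RiemMetric.at g x) (bochnerOperator g η x) (fun X => η x X)

/-! ### Hypersurfaces of the unit sphere -/

/-- The differential of `f : M → 𝕊ⁿ⁺¹ ⊂ ℝⁿ⁺²` as a map into `ℝⁿ⁺²`. -/
def ambientDeriv (f : M → Metric.sphere (0 : EuclideanSpace ℝ (Fin (n + 2))) 1) (x : M) :
    TangentSpace (𝓡 n) x →L[ℝ] EuclideanSpace ℝ (Fin (n + 2)) :=
  mfderiv (𝓡 n) 𝓘(ℝ, EuclideanSpace ℝ (Fin (n + 2)))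
    (fun p => (f p : EuclideanSpace ℝ (Fin (n + 2)))) x

/-- `f : (M, g) → 𝕊ⁿ⁺¹` is a smooth isometric immersion into the unit sphere with its round
metric. -/
def IsIsometricImmersion (g : RiemMetric n M)
    (f : M → Metric.sphere (0 : EuclideanSpace ℝ (Fin (n + 2))) 1) : Prop :=
  ContMDiff (𝓡 n) (𝓡 (n + 1)) ∞ f ∧
    ∀ (x : M) (X Y : TangentSpace (𝓡 n) x),
      ⟪ambientDeriv f x X, ambientDeriv f x Y⟫ = RiemMetric.at g x X Y

/-- The normal space of `f` in the sphere at `x`: the vectors of `ℝⁿ⁺²` orthogonal to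
`f_*(T_x M)` and to the position vector `f x`. -/
def normalSpace (f : M → Metric.sphere (0 : EuclideanSpace ℝ (Fin (n + 2))) 1) (x : M) :
    Submodule ℝ (EuclideanSpace ℝ (Fin (n + 2))) :=
  (Submodule.span ℝ
    (insert (f x : EuclideanSpace ℝ (Fin (n + 2))) (Set.range (ambientDeriv f x))))ᗮ

/-- The second fundamental form `α(X, Y)` of `f` in the sphere: the normal component of the
second derivative of `f` in a chart. -/
def secondFundamentalForm (f : M → Metric.sphere (0 : EuclideanSpace ℝ (Fin (n + 2))) 1)
    (x : M) (X Y : TangentSpace (𝓡 n) x) : EuclideanSpace ℝ (Fin (n + 2)) :=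
  (normalSpace f x).starProjection
    (fderiv ℝ (fun y => fderiv ℝ
        (fun z => (f ((extChartAt (𝓡 n) x).symm z) : EuclideanSpace ℝ (Fin (n + 2)))) y
        (chartDeriv x Y))
      (extChartAt (𝓡 n) x x) (chartDeriv x X))

/-- The normalized mean curvature vector `(1/n) tr α`. -/
def meanCurvatureVector (g : RiemMetric n M)
    (f : M → Metric.sphere (0 : EuclideanSpace ℝ (Fin (n + 2))) 1) (x : M) :
    EuclideanSpace ℝ (Fin (n + 2)) :=
  (n : ℝ)⁻¹ • ∑ i, ∑ j, invGram (coordFrame x) (RiemMetric.at g x) i j •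
    secondFundamentalForm f x (coordFrame x i) (coordFrame x j)

/-- The length `H` of the mean curvature vector. -/
def meanCurvature (g : RiemMetric n M)
    (f : M → Metric.sphere (0 : EuclideanSpace ℝ (Fin (n + 2))) 1) (x : M) : ℝ :=
  ‖meanCurvatureVector g f x‖

/-- `b(n, k, H)`. -/
def pinchingBound (n k : ℕ) (H : ℝ) : ℝ :=
  (n : ℝ) * ((k : ℝ) - 1) / k
    + (n : ℝ) * ((k : ℝ) - 1) * H / (2 * (k : ℝ) ^ 2)
      * ((n : ℝ) * H + √((n : ℝ) ^ 2 * H ^ 2 + 4 * (k : ℝ) * ((n : ℝ) - (k : ℝ))))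

/-- The pinching condition `Ric_M ≥ b(n, k, H)` at every point, on unit tangent vectors. -/
def RicciPinched (g : RiemMetric n M)
    (f : M → Metric.sphere (0 : EuclideanSpace ℝ (Fin (n + 2))) 1) (k : ℕ) : Prop :=
  ∀ (x : M) (X : TangentSpace (𝓡 n) x), RiemMetric.at g x X X = 1 →
    pinchingBound n k (meanCurvature g f x) ≤ ricciTensor g x X X

end HypersurfaceBochner

end

noncomputable section

namespace HypersurfaceBochner

open Function Finset

/-! ### Multilinear and alternating functions -/

section Algebra

variable {V : Type*} [AddCommGroup V] [Module ℝ V] {k : ℕ}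

/-! The statement is pointwise, because the Bochner operator is algebraic in the curvature. In
coordinates, `d` is the alternation of `∇` (the connection is torsion-free) and `δ` is minus a
metric contraction of `∇`. Since `∇` commutes with alternation and with contraction
(`covDeriv_extD`, `covDeriv_codiff`), `dδ + δd` differs from `∇*∇` only by commutators of second
covariant derivatives. The Ricci identity turns these into curvature acting as a derivation, which
is the Weitzenböck formula `hodge_sub_rough`.

For a hypersurface of the unit sphere the Gauss equation (`isGaussCurvature_of_sphere`) expresses
the curvature through the metric and the scalar second fundamental form `h`. In an orthonormal frame
diagonalizing `h`, with principal curvatures `λ_a`, the curvature term is diagonal too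
(`IsAlt.sum_derivAction_frame`). On the component with distinct indices `A` it multiplies by `∑_{i ∈
A, j ∉ A} (1 + λ_i λ_j) = k(n - k) + S(T - S)`, where `T` is the sum of all `λ_a` and `S` the sum
over `A`. This is nonnegative exactly when `S` lies between `(T - D)/2` and `(T + D)/2`, with `D² =
T² + 4k(n - k)`.

The Ricci curvature in the direction `E_b` is `n - 1 + λ_b(T - λ_b)`, and `|T| = nH`. The bound
`b(n,k,H)` is calibrated so that, for `T ≥ 0`, pinching means that every `λ_b` lies between `T - p`
and `p`, where `p = (T + D)/(2k)`. Adding `k` of these inequalities confines `S` to the required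
interval (`eigenvalue_nonneg`). The pointwise estimate is `weitzenbockTerm_nonneg`;
`bochnerNonneg_of_pinched` applies it in the preferred chart at each point. -/

/-- A function of `k` vectors that is linear in each of them. -/
def IsMultilin (S : (Fin k → V) → ℝ) : Prop :=
  ∀ (v : Fin k → V) (i : Fin k) (a b : ℝ) (x y : V),
    S (update v i (a • x + b • y)) = a * S (update v i x) + b * S (update v i y)

/-- A multilinear function that vanishes when two arguments agree. -/
def IsAlt (S : (Fin k → V) → ℝ) : Prop :=
  IsMultilin S ∧ ∀ (v : Fin k → V) (i j : Fin k), v i = v j → i ≠ j → S v = 0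

/-- The action of an endomorphism as a derivation, `v ↦ ∑ s, S (v₁, …, L v_s, …, v_k)`. -/
def derivAction (L : V → V) (S : (Fin k → V) → ℝ) (v : Fin k → V) : ℝ :=
  ∑ s, S (update v s (L (v s)))

theorem IsMultilin.sum {ι : Type*} {t : Finset ι} {S : ι → (Fin k → V) → ℝ}
    (h : ∀ i ∈ t, IsMultilin (S i)) : IsMultilin (fun v => ∑ i ∈ t, S i v) := by
  intro v i a b x y
  simp only [mul_sum, ← sum_add_distrib]
  exact sum_congr rfl fun j hj => h j hj v i a b x y

theorem IsMultilin.const_mul {S : (Fin k → V) → ℝ} (h : IsMultilin S) (c : ℝ) :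
    IsMultilin (fun v => c * S v) := by
  intro v i a b x y
  simp only [h v i a b x y]; ring

theorem IsMultilin.neg {S : (Fin k → V) → ℝ} (h : IsMultilin S) :
    IsMultilin (fun v => -S v) := by
  intro v i a b x y
  simp only [h v i a b x y]; ring

theorem IsMultilin.sub {S T : (Fin k → V) → ℝ} (h : IsMultilin S) (h' : IsMultilin T) :
    IsMultilin (fun v => S v - T v) := by
  intro v i a b x y
  simp only [h v i a b x y, h' v i a b x y]; ring

theorem IsAlt.sum {ι : Type*} {t : Finset ι} {S : ι → (Fin k → V) → ℝ}
    (h : ∀ i ∈ t, IsAlt (S i)) : IsAlt (fun v => ∑ i ∈ t, S i v) :=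
  ⟨.sum fun i hi => (h i hi).1, fun v i j hv hij =>
    sum_eq_zero fun a ha => (h a ha).2 v i j hv hij⟩

theorem IsAlt.const_mul {S : (Fin k → V) → ℝ} (h : IsAlt S) (c : ℝ) :
    IsAlt (fun v => c * S v) :=
  ⟨h.1.const_mul c, fun v i j hv hij => by simp [h.2 v i j hv hij]⟩

theorem IsAlt.neg {S : (Fin k → V) → ℝ} (h : IsAlt S) : IsAlt (fun v => -S v) :=
  ⟨h.1.neg, fun v i j hv hij => by simp [h.2 v i j hv hij]⟩

theorem IsAlt.sub {S T : (Fin k → V) → ℝ} (h : IsAlt S) (h' : IsAlt T) :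
    IsAlt (fun v => S v - T v) :=
  ⟨h.1.sub h'.1, fun v i j hv hij => by simp [h.2 v i j hv hij, h'.2 v i j hv hij]⟩

/-- The bundled multilinear map. -/
def IsMultilin.toMap {S : (Fin k → V) → ℝ} (h : IsMultilin S) :
    MultilinearMap ℝ (fun _ : Fin k => V) ℝ where
  toFun := S
  map_update_add' v i x y := by
    have := h v i 1 1 x y
    simp only [one_smul, one_mul] at this
    convert this
  map_update_smul' v i c x := by
    have := h v i c 0 x 0
    simp only [zero_smul, add_zero, zero_mul] at this
    rw [smul_eq_mul]
    convert this

/-- The bundled alternating map. -/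
def IsAlt.toMap {S : (Fin k → V) → ℝ} (h : IsAlt S) : V [⋀^Fin k]→ₗ[ℝ] ℝ where
  __ := h.1.toMap
  map_eq_zero_of_eq' := h.2

theorem IsMultilin.map_update_sum {ι : Type*} {S : (Fin k → V) → ℝ} (h : IsMultilin S)
    (v : Fin k → V) (i : Fin k) (t : Finset ι) (c : ι → ℝ) (x : ι → V) :
    S (update v i (∑ j ∈ t, c j • x j)) = ∑ j ∈ t, c j * S (update v i (x j)) := by
  have := h.toMap.map_update_sum t i (fun j => c j • x j) v
  simp only [MultilinearMap.map_update_smul, smul_eq_mul] at this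
  exact this

theorem IsMultilin.map_update_sub {S : (Fin k → V) → ℝ} (h : IsMultilin S)
    (v : Fin k → V) (i : Fin k) (x y : V) :
    S (update v i (x - y)) = S (update v i x) - S (update v i y) :=
  h.toMap.map_update_sub v i x y

theorem IsMultilin.map_update_add {S : (Fin k → V) → ℝ} (h : IsMultilin S)
    (v : Fin k → V) (i : Fin k) (x y : V) :
    S (update v i (x + y)) = S (update v i x) + S (update v i y) :=
  h.toMap.map_update_add v i x y

theorem IsMultilin.map_update_smul {S : (Fin k → V) → ℝ} (h : IsMultilin S)
    (v : Fin k → V) (i : Fin k) (c : ℝ) (x : V) :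
    S (update v i (c • x)) = c * S (update v i x) :=
  h.toMap.map_update_smul v i c x

theorem IsMultilin.derivAction {S : (Fin k → V) → ℝ} (h : IsMultilin S) {L : V → V}
    (hL : IsLinearMap ℝ L) : IsMultilin (derivAction L S) := by
  refine IsMultilin.sum fun s _ => ?_
  intro v i a b x y
  by_cases his : s = i
  · subst his
    simp only [update_self, update_idem, hL.map_add, hL.map_smul, h v s a b]
  · simp only [update_of_ne his, update_comm (Ne.symm his), h _ i a b]

theorem IsAlt.map_swap {S : (Fin k → V) → ℝ} (h : IsAlt S) (v : Fin k → V) {i j : Fin k}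
    (hij : i ≠ j) : S (v ∘ Equiv.swap i j) = -S v :=
  h.toMap.map_swap v hij

theorem IsAlt.map_perm {S : (Fin k → V) → ℝ} (h : IsAlt S) (v : Fin k → V)
    (σ : Equiv.Perm (Fin k)) : S (v ∘ σ) = (Equiv.Perm.sign σ : ℤ) * S v := by
  have := h.toMap.map_perm v σ
  rw [Units.smul_def, zsmul_eq_mul] at this
  exact this

theorem IsAlt.derivAction {S : (Fin k → V) → ℝ} (h : IsAlt S) {L : V → V}
    (hL : IsLinearMap ℝ L) : IsAlt (derivAction L S) := by
  refine ⟨h.1.derivAction hL, fun v i j hv hij => ?_⟩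
  have h0 : ∀ s, s ≠ i → s ≠ j → S (update v s (L (v s))) = 0 := fun s hsi hsj =>
    h.2 _ i j (by rw [update_of_ne hsi.symm, update_of_ne hsj.symm, hv]) hij
  have : HypersurfaceBochner.derivAction L S v
      = S (update v i (L (v i))) + S (update v j (L (v j))) := by
    rw [HypersurfaceBochner.derivAction, ← sum_pair (f := fun s => S (update v s (L (v s)))) hij]
    symm
    apply sum_subset (subset_univ _)
    intro s _ hs
    simp only [mem_insert, mem_singleton, not_or] at hs
    exact h0 s hs.1 hs.2
  rw [this]
  -- The two surviving terms differ by a transposition of slots, so they cancel.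
  have h2 : update v j (L (v j)) = update v i (L (v i)) ∘ Equiv.swap i j := by
    ext s
    by_cases hsi : s = i
    · subst hsi; simp [hij, hij.symm, hv]
    · by_cases hsj : s = j
      · subst hsj; simp [hv]
      · simp [Equiv.swap_apply_of_ne_of_ne hsi hsj, hsi, hsj]
  rw [h2, h.map_swap _ hij]; ring

/-- Terms with `A` and `B` in different slots are symmetric in the pair and cancel. Those in the
same slot survive, composed in reversed order because the action is by precomposition. This produces
the `ΓΓ` part of the curvature in the Ricci identity. -/
theorem derivAction_commutator {V : Type*} {k : ℕ} (S : (Fin k → V) → ℝ) (A B : V → V)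
    (v : Fin k → V) :
    derivAction A (derivAction B S) v - derivAction B (derivAction A S) v
      = ∑ s, (S (update v s (B (A (v s)))) - S (update v s (A (B (v s))))) := by
  have key : ∀ (A B : V → V), derivAction A (derivAction B S) v
      = ∑ s, S (update v s (B (A (v s))))
        + ∑ s, ∑ t, if s = t then 0 else S (update (update v s (A (v s))) t (B (v t))) := by
    intro A B
    rw [derivAction, ← sum_add_distrib]
    refine sum_congr rfl fun s _ => ?_
    rw [derivAction, ← add_sum_erase univ _ (mem_univ s)]
    rw [← add_sum_erase univ (fun t => if s = t then (0 : ℝ) else _) (mem_univ s)]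
    simp only [update_self, update_idem, if_true, zero_add]
    congr 1
    refine sum_congr rfl fun t ht => ?_
    have hts : t ≠ s := ne_of_mem_erase ht
    rw [if_neg hts.symm, update_of_ne hts]
  have comm : (∑ s, ∑ t, if s = t then 0 else S (update (update v s (A (v s))) t (B (v t))))
      = ∑ s, ∑ t, if s = t then 0 else S (update (update v s (B (v s))) t (A (v t))) := by
    rw [sum_comm]
    refine sum_congr rfl fun s _ => sum_congr rfl fun t _ => ?_
    by_cases hst : s = t
    · simp [hst]
    · rw [if_neg hst, if_neg (Ne.symm hst), update_comm hst]
  rw [key A B, key B A, comm, sum_sub_distrib]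
  ring

/-- A symmetric bilinear operation drops out of the alternating sum over the removed argument. -/
theorem IsAlt.alternating_sum_derivAction {S : (Fin k → V) → ℝ} (h : IsAlt S)
    {Γ : V → V → V} (hΓ : ∀ u v, Γ u v = Γ v u) (v : Fin (k + 1) → V) :
    ∑ i : Fin (k + 1), (-1 : ℝ) ^ (i : ℕ) *
      HypersurfaceBochner.derivAction (Γ (v i)) S (fun s => v (i.succAbove s)) = 0 := by
  -- `a i j` is the signed term with argument `i` removed and argument `j` replaced by `Γ(v_i,
  -- v_j)`. The sum vanishes because `a` is antisymmetric.
  set a : Fin (k + 1) → Fin (k + 1) → ℝ := fun i j =>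
    if i = j then 0 else (-1 : ℝ) ^ (i : ℕ) * S (i.removeNth (update v j (Γ (v i) (v j)))) with ha
  have h1 : ∀ i : Fin (k + 1), (-1 : ℝ) ^ (i : ℕ) *
      HypersurfaceBochner.derivAction (Γ (v i)) S (fun s => v (i.succAbove s)) = ∑ j, a i j := by
    intro i
    rw [Fin.sum_univ_succAbove _ i, HypersurfaceBochner.derivAction, mul_sum]
    simp only [ha, if_true, zero_add]
    refine sum_congr rfl fun s _ => ?_
    rw [if_neg (Fin.succAbove_ne i s).symm]
    congr 2
    ext t
    by_cases hts : t = s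
    · subst hts; simp [Fin.removeNth]
    · simp [Fin.removeNth, hts]
  have h2 : ∀ i j, a i j = -a j i := by
    intro i j
    by_cases hij : i = j
    · simp [ha, hij]
    · simp only [ha, if_neg hij, if_neg (Ne.symm hij)]
      set w := Γ (v i) (v j) with hw
      -- Put `w` in both slots `i` and `j`. With equal entries there, removing one or the other
      -- gives opposite signed values, and these are `a i j` and `a j i`.
      have := h.toMap.neg_one_pow_smul_map_removeNth_add_eq_zero_of_eq
        (v := update (update v i w) j w) (i := i) (j := j)
        (by rw [update_self, update_of_ne hij, update_self]) hij
      have e1 : i.removeNth (update (update v i w) j w) = i.removeNth (update v j w) := by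
        rw [update_comm hij]; exact Fin.removeNth_update i _ _
      have e2 : j.removeNth (update (update v i w) j w) = j.removeNth (update v i w) :=
        Fin.removeNth_update j _ _
      rw [e1, e2] at this
      rw [hΓ (v j) (v i), ← hw]
      simp only [zsmul_eq_mul] at this
      push_cast at this
      change (-1 : ℝ) ^ (i : ℕ) * S _ + (-1 : ℝ) ^ (j : ℕ) * S _ = 0 at this
      linarith
  simp only [h1]
  have h3 : ∑ i, ∑ j, a i j = -∑ i, ∑ j, a i j := by
    conv_lhs => rw [sum_comm]
    simp only [← sum_neg_distrib]
    exact sum_congr rfl fun i _ => sum_congr rfl fun j _ => h2 j i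
  linarith

end Algebra

/-! ### Metrics on open sets of `ℝⁿ` -/

/-- The model space. -/
abbrev Eu (n : ℕ) : Type := EuclideanSpace ℝ (Fin n)

theorem sum_coord_smul_e {n : ℕ} (v : Eu n) : ∑ i, v i • e n i = v := by
  have := (EuclideanSpace.basisFun (Fin n) ℝ).sum_repr v
  simpa [e] using this

theorem e_apply {n : ℕ} (i j : Fin n) : e n i j = if j = i then 1 else 0 := by
  simp [e]

/-- `G` is bilinear and symmetric, and restricts to a smooth Riemannian metric on the open
set `U`. -/
structure IsMetricOn {n : ℕ} (G : MetricField n) (U : Set (Eu n)) : Prop where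
  isOpen : IsOpen U
  lin : ∀ y (a b : ℝ) u v w, G y (a • u + b • v) w = a * G y u w + b * G y v w
  symm : ∀ y u v, G y u v = G y v u
  pos : ∀ y ∈ U, ∀ u, u ≠ 0 → 0 < G y u u
  smooth : ∀ u v, ContDiffOn ℝ ∞ (fun z => G z u v) U

/-! ### Differential calculus on open subsets of `ℝⁿ`. -/

section Smooth

variable {n : ℕ} {U : Set (Eu n)} {F : Type*} [NormedAddCommGroup F] [NormedSpace ℝ F]

theorem contDiffOn_fderiv_apply (hU : IsOpen U) {f : Eu n → F} (hf : ContDiffOn ℝ ∞ f U)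
    (u : Eu n) : ContDiffOn ℝ ∞ (fun z => fderiv ℝ f z u) U :=
  (hf.fderiv_of_isOpen hU (by simp)).clm_apply contDiffOn_const

theorem diffAt_of_contDiffOn (hU : IsOpen U) {f : Eu n → F} (hf : ContDiffOn ℝ ∞ f U)
    {y : Eu n} (hy : y ∈ U) : DifferentiableAt ℝ f y :=
  (hf.contDiffAt (hU.mem_nhds hy)).differentiableAt (by simp)

theorem fderiv_congr_of_eqOn (hU : IsOpen U) {f g : Eu n → F} (h : ∀ z ∈ U, f z = g z)
    {y : Eu n} (hy : y ∈ U) : fderiv ℝ f y = fderiv ℝ g y :=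
  Filter.EventuallyEq.fderiv_eq (Filter.eventually_of_mem (hU.mem_nhds hy) h)

/-- Coordinates of a derivative. -/
theorem fderiv_coord {f : Eu n → Eu n} {y : Eu n} (hf : DifferentiableAt ℝ f y) (u : Eu n)
    (i : Fin n) : fderiv ℝ (fun z => f z i) y u = (fderiv ℝ f y u) i := by
  have := ((EuclideanSpace.proj (𝕜 := ℝ) i : Eu n →L[ℝ] ℝ).hasFDerivAt.comp y
    hf.hasFDerivAt).fderiv
  change fderiv ℝ (fun z => f z i) y = _ at this
  rw [this]; rfl

theorem fderiv_sum_apply {ι : Type*} {t : Finset ι} {f : ι → Eu n → ℝ} {y : Eu n}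
    (hf : ∀ i ∈ t, DifferentiableAt ℝ (f i) y) (u : Eu n) :
    fderiv ℝ (fun z => ∑ i ∈ t, f i z) y u = ∑ i ∈ t, fderiv ℝ (f i) y u := by
  rw [fderiv_fun_sum hf, _root_.sum_apply]

theorem fderiv_mul_apply {f g : Eu n → ℝ} {y : Eu n} (hf : DifferentiableAt ℝ f y)
    (hg : DifferentiableAt ℝ g y) (u : Eu n) :
    fderiv ℝ (fun z => f z * g z) y u = fderiv ℝ f y u * g y + f y * fderiv ℝ g y u := by
  rw [fderiv_fun_mul hf hg]; simp; ring

theorem fderiv_sub_apply {f g : Eu n → ℝ} {y : Eu n} (hf : DifferentiableAt ℝ f y)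
    (hg : DifferentiableAt ℝ g y) (u : Eu n) :
    fderiv ℝ (fun z => f z - g z) y u = fderiv ℝ f y u - fderiv ℝ g y u := by
  rw [fderiv_fun_sub hf hg]; simp

theorem fderiv_lincomb_apply {f g : Eu n → ℝ} {y : Eu n} (hf : DifferentiableAt ℝ f y)
    (hg : DifferentiableAt ℝ g y) (a b : ℝ) (u : Eu n) :
    fderiv ℝ (fun z => a * f z + b * g z) y u
      = a * fderiv ℝ f y u + b * fderiv ℝ g y u := by
  rw [fderiv_fun_add (hf.const_mul a) (hg.const_mul b), fderiv_const_mul hf, fderiv_const_mul hg]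
  simp

theorem isLinearMap_of_lin {V W : Type*} [AddCommGroup V] [Module ℝ V] [AddCommGroup W]
    [Module ℝ W] {f : V → W} (h : ∀ (a b : ℝ) u v, f (a • u + b • v) = a • f u + b • f v) :
    IsLinearMap ℝ f where
  map_add u v := by simpa using h 1 1 u v
  map_smul c u := by simpa using h c 0 u 0

theorem isLinearMap_map_sum {V W ι : Type*} [AddCommGroup V] [Module ℝ V] [AddCommGroup W]
    [Module ℝ W] {f : V → W} (h : IsLinearMap ℝ f) (t : Finset ι) (c : ι → ℝ) (x : ι → V) :
    f (∑ i ∈ t, c i • x i) = ∑ i ∈ t, c i • f (x i) := by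
  have := map_sum (h.mk' f) (fun i => c i • x i) t
  simp only [map_smul, IsLinearMap.mk'_apply] at this
  exact this

end Smooth

/-! ### The inverse metric and the Levi-Civita connection. -/

namespace IsMetricOn

variable {n : ℕ} {G : MetricField n} {U : Set (Eu n)} (hG : IsMetricOn G U)
include hG

theorem lin_right (y : Eu n) (a b : ℝ) (u v w : Eu n) :
    G y w (a • u + b • v) = a * G y w u + b * G y w v := by
  rw [hG.symm, hG.lin, hG.symm y u, hG.symm y v]

theorem isLinear_left (y w : Eu n) : IsLinearMap ℝ (fun u => G y u w) :=
  isLinearMap_of_lin fun a b u v => hG.lin y a b u v w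

theorem isLinear_right (y w : Eu n) : IsLinearMap ℝ (fun u => G y w u) :=
  isLinearMap_of_lin fun a b u v => hG.lin_right y a b u v w

theorem sum_left {ι : Type*} (y : Eu n) (t : Finset ι) (c : ι → ℝ) (x : ι → Eu n) (w : Eu n) :
    G y (∑ i ∈ t, c i • x i) w = ∑ i ∈ t, c i * G y (x i) w :=
  isLinearMap_map_sum (hG.isLinear_left y w) t c x

theorem sum_right {ι : Type*} (y : Eu n) (t : Finset ι) (c : ι → ℝ) (x : ι → Eu n) (w : Eu n) :
    G y w (∑ i ∈ t, c i • x i) = ∑ i ∈ t, c i * G y w (x i) :=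
  isLinearMap_map_sum (hG.isLinear_right y w) t c x

theorem expand_left (y u w : Eu n) : G y u w = ∑ i, u i * G y (e n i) w := by
  conv_lhs => rw [← sum_coord_smul_e u]
  rw [hG.sum_left]

theorem expand_right (y u w : Eu n) : G y w u = ∑ i, u i * G y w (e n i) := by
  conv_lhs => rw [← sum_coord_smul_e u]
  rw [hG.sum_right]

theorem ext_of_inner {y : Eu n} (hy : y ∈ U) {u v : Eu n} (h : ∀ w, G y u w = G y v w) :
    u = v := by
  by_contra hne
  have hp := hG.pos y hy (u - v) (sub_ne_zero.mpr hne)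
  have := hG.lin y 1 (-1) u v (u - v)
  rw [h (u - v)] at this
  have h2 : (1 : ℝ) • u + (-1 : ℝ) • v = u - v := by module
  rw [h2] at this
  linarith

theorem posDef_gram {y : Eu n} (hy : y ∈ U) :
    (Matrix.of fun i j => G y (e n i) (e n j)).PosDef := by
  refine Matrix.PosDef.of_dotProduct_mulVec_pos ?_ ?_
  · ext i j; simp [hG.symm y (e n i) (e n j)]
  · intro x hx
    have hx' : WithLp.toLp 2 x ≠ (0 : Eu n) := by
      intro h0; apply hx
      ext i; exact congrArg (fun v : Eu n => v i) h0
    have := hG.pos y hy _ hx'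
    rw [hG.expand_left] at this
    simp only [hG.expand_right y (WithLp.toLp 2 x)] at this
    simpa [dotProduct, Matrix.mulVec, mul_comm] using this

theorem inv_mul_gram {y : Eu n} (hy : y ∈ U) :
    Coord.inv G y * (Matrix.of fun i j => G y (e n i) (e n j)) = 1 :=
  Matrix.nonsing_inv_mul _ ((hG.posDef_gram hy).det_pos.ne'.isUnit)

theorem gram_mul_inv {y : Eu n} (hy : y ∈ U) :
    (Matrix.of fun i j => G y (e n i) (e n j)) * Coord.inv G y = 1 :=
  Matrix.mul_nonsing_inv _ ((hG.posDef_gram hy).det_pos.ne'.isUnit)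

/-- Cramer's rule: adjugate entries and determinant are polynomials in the metric coefficients, and
the determinant is positive on `U`. -/
theorem contDiffOn_inv (i j : Fin n) : ContDiffOn ℝ ∞ (fun z => Coord.inv G z i j) U := by
  have hdet : ContDiffOn ℝ ∞
      (fun z => (Matrix.of fun i j => G z (e n i) (e n j)).det) U := by
    simp only [Matrix.det_apply']
    exact ContDiffOn.sum fun σ _ => contDiffOn_const.mul
      (contDiffOn_prod fun i _ => hG.smooth _ _)
  have hadj : ContDiffOn ℝ ∞
      (fun z => (Matrix.of fun i j => G z (e n i) (e n j)).adjugate i j) U := by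
    simp only [Matrix.adjugate_apply, Matrix.det_apply']
    refine ContDiffOn.sum fun σ _ => contDiffOn_const.mul (contDiffOn_prod fun l _ => ?_)
    by_cases h : σ l = j
    · simp only [Matrix.updateRow_apply, h, if_true]; exact contDiffOn_const
    · simp only [Matrix.updateRow_apply, h, if_false]; exact hG.smooth _ _
  have : ContDiffOn ℝ ∞ (fun z => ((Matrix.of fun i j => G z (e n i) (e n j)).det)⁻¹ *
      (Matrix.of fun i j => G z (e n i) (e n j)).adjugate i j) U :=
    (hdet.inv fun z hz => (hG.posDef_gram hz).det_pos.ne').mul hadj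
  refine this.congr fun z _ => ?_
  rw [Coord.inv, invGram, Matrix.inv_def, Ring.inverse_eq_inv', Matrix.smul_apply, smul_eq_mul]

theorem contDiffOn_christoffel (u v : Eu n) :
    ContDiffOn ℝ ∞ (fun z => Coord.christoffel G z u v) U := by
  have hd : ∀ a b c : Eu n, ContDiffOn ℝ ∞ (fun z => fderiv ℝ (fun z => G z a b) z c) U :=
    fun a b c => contDiffOn_fderiv_apply hG.isOpen (hG.smooth a b) c
  refine ContDiffOn.sum fun i _ => ContDiffOn.smul
    (f := fun z => ∑ l, Coord.inv G z i l * _) (ContDiffOn.sum fun l _ => ?_) contDiffOn_const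
  exact (hG.contDiffOn_inv i l).mul (contDiffOn_const.mul
    (((hd _ _ _).add (hd _ _ _)).sub (hd _ _ _)))

theorem diffAt {y : Eu n} (hy : y ∈ U) (u v : Eu n) : DifferentiableAt ℝ (fun z => G z u v) y :=
  diffAt_of_contDiffOn hG.isOpen (hG.smooth u v) hy

theorem fderiv_lin_right {y : Eu n} (hy : y ∈ U) (a b : ℝ) (u v w x : Eu n) :
    fderiv ℝ (fun z => G z w (a • u + b • v)) y x
      = a * fderiv ℝ (fun z => G z w u) y x + b * fderiv ℝ (fun z => G z w v) y x := by
  simp only [hG.lin_right]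
  exact fderiv_lincomb_apply (hG.diffAt hy _ _) (hG.diffAt hy _ _) a b x

theorem fderiv_symm (y u v : Eu n) :
    fderiv ℝ (fun z => G z u v) y = fderiv ℝ (fun z => G z v u) y := by
  simp only [hG.symm _ u v]

/-- The Koszul formula in coordinates. -/
theorem inner_christoffel {y : Eu n} (hy : y ∈ U) (u v w : Eu n) :
    G y (Coord.christoffel G y u v) w = (1 / 2 : ℝ) *
      (fderiv ℝ (fun z => G z v w) y u + fderiv ℝ (fun z => G z u w) y v
        - fderiv ℝ (fun z => G z u v) y w) := by
  set K : Eu n → ℝ := fun w => (1 / 2 : ℝ) *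
      (fderiv ℝ (fun z => G z v w) y u + fderiv ℝ (fun z => G z u w) y v
        - fderiv ℝ (fun z => G z u v) y w) with hK
  have hKlin : IsLinearMap ℝ K := isLinearMap_of_lin fun a b p q => by
    simp only [hK, hG.fderiv_lin_right hy, map_add, map_smul, smul_eq_mul]; ring
  have hc : Coord.christoffel G y u v = ∑ i, (∑ l, Coord.inv G y i l * K (e n l)) • e n i := rfl
  -- Both sides are linear in `w`, so coordinate vectors suffice; there the Gram matrix cancels the
  -- inverse metric in `christoffel`.
  have hbasis : ∀ m, G y (Coord.christoffel G y u v) (e n m) = K (e n m) := by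
    intro m
    rw [hc, hG.sum_left]
    simp only [sum_mul]
    rw [sum_comm]
    have : ∀ l, ∑ i, Coord.inv G y i l * K (e n l) * G y (e n i) (e n m)
        = (if m = l then 1 else 0) * K (e n l) := by
      intro l
      have h1 := congrFun (congrFun (hG.gram_mul_inv hy) m) l
      rw [Matrix.mul_apply, Matrix.one_apply] at h1
      rw [← h1, sum_mul]
      refine sum_congr rfl fun i _ => ?_
      simp only [Matrix.of_apply, hG.symm y (e n i) (e n m)]; ring
    simp only [this]
    simp
  rw [hG.expand_right]
  change _ = K w
  conv_rhs => rw [← sum_coord_smul_e w, isLinearMap_map_sum hKlin]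
  simp only [hbasis, smul_eq_mul]

theorem christoffel_symm (y u v : Eu n) :
    Coord.christoffel G y u v = Coord.christoffel G y v u := by
  unfold Coord.christoffel
  simp only [hG.fderiv_symm y u v]
  refine sum_congr rfl fun i _ => ?_
  congr 1
  refine sum_congr rfl fun l _ => ?_
  ring

/-- The right side of the Koszul formula is linear in `v`, and nondegeneracy of the metric passes
this on to `Γ`. -/
theorem christoffel_isLinear_right {y : Eu n} (hy : y ∈ U) (u : Eu n) :
    IsLinearMap ℝ (fun v => Coord.christoffel G y u v) := by
  refine isLinearMap_of_lin fun a b p q => hG.ext_of_inner hy fun w => ?_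
  have h2 : ∀ x, fderiv ℝ (fun z => G z (a • p + b • q) w) y x
      = a * fderiv ℝ (fun z => G z p w) y x + b * fderiv ℝ (fun z => G z q w) y x := by
    intro x
    simp only [hG.fderiv_symm y _ w, hG.fderiv_lin_right hy]
  rw [hG.lin]
  simp only [hG.inner_christoffel hy, h2, hG.fderiv_lin_right hy, map_add, map_smul, smul_eq_mul]
  ring

theorem christoffel_isLinear_left {y : Eu n} (hy : y ∈ U) (v : Eu n) :
    IsLinearMap ℝ (fun u => Coord.christoffel G y u v) := by
  simp only [hG.christoffel_symm y _ v]
  exact hG.christoffel_isLinear_right hy v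

/-- The Levi-Civita connection is metric. -/
theorem fderiv_metric {y : Eu n} (hy : y ∈ U) (u v w : Eu n) :
    fderiv ℝ (fun z => G z v w) y u
      = G y (Coord.christoffel G y u v) w + G y v (Coord.christoffel G y u w) := by
  rw [hG.symm y v, hG.inner_christoffel hy, hG.inner_christoffel hy, hG.fderiv_symm y w v]
  ring

/-- The inverse metric is parallel. -/
theorem sum_fderiv_inv {y : Eu n} (hy : y ∈ U) (u : Eu n) {B : Eu n → Eu n → ℝ}
    (hl : ∀ w, IsLinearMap ℝ (fun v => B v w)) (hr : ∀ v, IsLinearMap ℝ (fun w => B v w)) :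
    ∑ i, ∑ j, fderiv ℝ (fun z => Coord.inv G z i j) y u * B (e n i) (e n j)
      = -∑ i, ∑ j, Coord.inv G y i j *
        (B (Coord.christoffel G y u (e n i)) (e n j)
          + B (e n i) (Coord.christoffel G y u (e n j))) := by
  set M : Matrix (Fin n) (Fin n) ℝ := Matrix.of fun i j => G y (e n i) (e n j) with hM
  set N := Coord.inv G y with hN
  set dN : Matrix (Fin n) (Fin n) ℝ :=
    Matrix.of fun i j => fderiv ℝ (fun z => Coord.inv G z i j) y u with hdN
  set A : Matrix (Fin n) (Fin n) ℝ :=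
    Matrix.of fun a i => Coord.christoffel G y u (e n i) a with hA
  have hdM : ∀ i j, fderiv ℝ (fun z => G z (e n i) (e n j)) y u = (A.transpose * M + M * A) i j := by
    intro i j
    rw [hG.fderiv_metric hy, hG.expand_left y (Coord.christoffel G y u (e n i)),
      hG.expand_right y (Coord.christoffel G y u (e n j)), Matrix.add_apply, Matrix.mul_apply,
      Matrix.mul_apply]
    simp [hA, hM, mul_comm]
  -- Differentiate `N M = 1`, with the derivative of `M` given by metric compatibility. Multiplying
  -- by `N` on the right then isolates `dN`.
  have h1 : dN * M + N * (A.transpose * M + M * A) = 0 := by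
    ext i l
    have hc : ∀ z ∈ U, ∑ j, Coord.inv G z i j * G z (e n j) (e n l)
        = (1 : Matrix (Fin n) (Fin n) ℝ) i l := by
      intro z hz
      rw [← hG.inv_mul_gram hz, Matrix.mul_apply]; rfl
    have h2 := congrArg (fun L => L u) (fderiv_congr_of_eqOn hG.isOpen hc hy)
    have hdi : ∀ i j, DifferentiableAt ℝ (fun z => Coord.inv G z i j) y := fun i j =>
      diffAt_of_contDiffOn hG.isOpen (hG.contDiffOn_inv i j) hy
    simp only [fderiv_fun_const, Pi.zero_apply, _root_.zero_apply] at h2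
    rw [fderiv_sum_apply (f := fun j z => Coord.inv G z i j * G z (e n j) (e n l))
      fun j _ => (hdi i j).mul (hG.diffAt hy _ _)] at h2
    simp only [fderiv_mul_apply (hdi i _) (hG.diffAt hy _ _), hdM, sum_add_distrib] at h2
    rw [Matrix.add_apply, Matrix.mul_apply, Matrix.mul_apply, Matrix.zero_apply]
    exact h2
  have hNM : N * M = 1 := hG.inv_mul_gram hy
  have hMN : M * N = 1 := hG.gram_mul_inv hy
  have h3 : dN = -(N * A.transpose + A * N) := by
    have : (dN * M + N * (A.transpose * M + M * A)) * N = 0 := by rw [h1, zero_mul]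
    have h4 : (dN * M + N * (A.transpose * M + M * A)) * N
        = dN * (M * N) + N * A.transpose * (M * N) + (N * M) * A * N := by
      noncomm_ring
    rw [h4, hMN, hNM] at this
    simp only [mul_one, one_mul] at this
    rw [eq_neg_iff_add_eq_zero, ← this, add_assoc]
  have h5 : ∀ i j, fderiv ℝ (fun z => Coord.inv G z i j) y u = dN i j := fun i j => rfl
  have hBl : ∀ i w, B (Coord.christoffel G y u (e n i)) w = ∑ a, A a i * B (e n a) w := by
    intro i w
    conv_lhs => rw [← sum_coord_smul_e (Coord.christoffel G y u (e n i))]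
    exact isLinearMap_map_sum (hl w) _ _ _
  have hBr : ∀ i w, B w (Coord.christoffel G y u (e n i)) = ∑ a, A a i * B w (e n a) := by
    intro i w
    conv_lhs => rw [← sum_coord_smul_e (Coord.christoffel G y u (e n i))]
    exact isLinearMap_map_sum (hr w) _ _ _
  simp only [h5, h3, hBl, hBr, Matrix.neg_apply, Matrix.add_apply, Matrix.mul_apply,
    Matrix.transpose_apply, neg_mul, sum_neg_distrib, add_mul, mul_add, sum_add_distrib, sum_mul,
    mul_sum]
  congr 1
  rw [add_comm]
  congr 1
  · rw [sum_comm]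
    conv_rhs => rw [sum_comm]
    refine sum_congr rfl fun j _ => ?_
    rw [sum_comm]
    exact sum_congr rfl fun i _ => sum_congr rfl fun l _ => by ring
  · refine sum_congr rfl fun i _ => ?_
    rw [sum_comm]
    exact sum_congr rfl fun j _ => sum_congr rfl fun l _ => by ring

end IsMetricOn

/-! ### The Weitzenböck formula in coordinates -/

/-- `T` is a field of alternating forms that is smooth on `U`. -/
structure IsFormOn {n k : ℕ} (T : TensorField n k) (U : Set (Eu n)) : Prop where
  alt : ∀ y, IsAlt (T y)
  smooth : ∀ v, ContDiffOn ℝ ∞ (fun z => T z v) U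

theorem fderiv_fderiv_comm {n : ℕ} {U : Set (Eu n)} {F : Type*} [NormedAddCommGroup F]
    [NormedSpace ℝ F] (hU : IsOpen U) {f : Eu n → F} (hf : ContDiffOn ℝ ∞ f U) {y : Eu n}
    (hy : y ∈ U) (u v : Eu n) :
    fderiv ℝ (fun z => fderiv ℝ f z v) y u = fderiv ℝ (fun z => fderiv ℝ f z u) y v := by
  have hd : DifferentiableAt ℝ (fderiv ℝ f) y :=
    ((hf.fderiv_of_isOpen (m := ∞) hU (by simp)).contDiffAt (hU.mem_nhds hy)).differentiableAt
      (by simp)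
  have h1 : ∀ v u, fderiv ℝ (fun z => fderiv ℝ f z v) y u = fderiv ℝ (fderiv ℝ f) y u v := by
    intro v u
    rw [fderiv_clm_apply hd (differentiableAt_const v)]
    simp
  rw [h1, h1]
  exact ((hf.contDiffAt (hU.mem_nhds hy)).isSymmSndFDerivAt
    (by
    rw [minSmoothness_of_isRCLikeNormedField]; exact WithTop.coe_le_coe.2 le_top)) u v

/-! ### Leibniz rule for forms evaluated on a variable vector. -/

section Update

variable {n k : ℕ} {T : TensorField n k} {U : Set (Eu n)}

theorem IsFormOn.apply_update_eq (hT : IsFormOn T U) (v : Fin k → Eu n) (s : Fin k) (z c : Eu n) :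
    T z (update v s c) = ∑ i, c i * T z (update v s (e n i)) := by
  conv_lhs => rw [← sum_coord_smul_e c]
  exact (hT.alt z).1.map_update_sum v s _ _ _

theorem contDiffOn_coord {c : Eu n → Eu n} (hc : ContDiffOn ℝ ∞ c U) (i : Fin n) :
    ContDiffOn ℝ ∞ (fun z => c z i) U :=
  (EuclideanSpace.proj (𝕜 := ℝ) i : Eu n →L[ℝ] ℝ).contDiff.comp_contDiffOn hc

theorem IsFormOn.contDiffOn_update (hT : IsFormOn T U) (v : Fin k → Eu n) (s : Fin k)
    {c : Eu n → Eu n} (hc : ContDiffOn ℝ ∞ c U) :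
    ContDiffOn ℝ ∞ (fun z => T z (update v s (c z))) U := by
  simp only [hT.apply_update_eq v s _ (c _)]
  exact ContDiffOn.sum fun i _ => (contDiffOn_coord hc i).mul (hT.smooth _)

/-- Expanding `c` in the coordinate basis reduces this to the product rule. It is needed because the
Christoffel vectors inserted in the slots of `∇T` depend on the point. -/
theorem IsFormOn.fderiv_update (hT : IsFormOn T U) (hU : IsOpen U) (v : Fin k → Eu n) (s : Fin k)
    {c : Eu n → Eu n} (hc : ContDiffOn ℝ ∞ c U) {y : Eu n} (hy : y ∈ U) (u : Eu n) :
    fderiv ℝ (fun z => T z (update v s (c z))) y u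
      = fderiv ℝ (fun z => T z (update v s (c y))) y u
        + T y (update v s (fderiv ℝ c y u)) := by
  have hd : ∀ v, DifferentiableAt ℝ (fun z => T z v) y := fun v =>
    diffAt_of_contDiffOn hU (hT.smooth v) hy
  have hci : ∀ i, DifferentiableAt ℝ (fun z => c z i) y := fun i =>
    diffAt_of_contDiffOn hU (contDiffOn_coord hc i) hy
  have h1 : fderiv ℝ (fun z => T z (update v s (c z))) y u
      = ∑ i, ((fderiv ℝ c y u) i * T y (update v s (e n i))
        + c y i * fderiv ℝ (fun z => T z (update v s (e n i))) y u) := by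
    simp only [hT.apply_update_eq v s _ (c _)]
    rw [fderiv_sum_apply (f := fun i z => c z i * T z (update v s (e n i)))
      fun i _ => (hci i).mul (hd _)]
    refine sum_congr rfl fun i _ => ?_
    rw [fderiv_mul_apply (hci i) (hd _), fderiv_coord (diffAt_of_contDiffOn hU hc hy)]
  have h2 : fderiv ℝ (fun z => T z (update v s (c y))) y u
      = ∑ i, c y i * fderiv ℝ (fun z => T z (update v s (e n i))) y u := by
    simp only [hT.apply_update_eq v s _ (c _)]
    rw [fderiv_sum_apply (f := fun i z => c y i * T z (update v s (e n i)))
      fun i _ => (hd _).const_mul _]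
    refine sum_congr rfl fun i _ => ?_
    rw [fderiv_const_mul (hd _)]; simp
  rw [h1, h2, hT.apply_update_eq v s y (fderiv ℝ c y u), sum_add_distrib, add_comm]

end Update

section Weitzenbock

variable {n k : ℕ} {G : MetricField n} {U : Set (Eu n)} {T : TensorField n k}

open Coord

theorem covDeriv_cons (S : TensorField n k) (y u : Eu n) (w : Fin k → Eu n) :
    covDeriv G S y (Fin.cons u w)
      = fderiv ℝ (fun z => S z w) y u - derivAction (christoffel G y u) (S y) w := by
  simp [covDeriv, derivAction]

theorem covDeriv_contDiffOn (hG : IsMetricOn G U) (hT : IsFormOn T U) (v : Fin (k + 1) → Eu n) :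
    ContDiffOn ℝ ∞ (fun z => covDeriv G T z v) U :=
  (contDiffOn_fderiv_apply hG.isOpen (hT.smooth _) _).sub
    (ContDiffOn.sum fun s _ => hT.contDiffOn_update _ s (hG.contDiffOn_christoffel _ _))

theorem IsFormOn.fderiv_isAlt (hT : IsFormOn T U) (hU : IsOpen U) {y : Eu n} (hy : y ∈ U)
    (u : Eu n) : IsAlt (fun w => fderiv ℝ (fun z => T z w) y u) := by
  have hd : ∀ v, DifferentiableAt ℝ (fun z => T z v) y := fun v =>
    diffAt_of_contDiffOn hU (hT.smooth v) hy
  refine ⟨fun v i a b x x' => ?_, fun v i j hv hij => ?_⟩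
  · simp only [(hT.alt _).1 v i a b x x']
    exact fderiv_lincomb_apply (hd _) (hd _) a b u
  · simp only [(hT.alt _).2 v i j hv hij]
    simp

theorem covDeriv_isAlt (hG : IsMetricOn G U) (hT : IsFormOn T U) {y : Eu n} (hy : y ∈ U)
    (u : Eu n) : IsAlt (fun w => covDeriv G T y (Fin.cons u w)) := by
  simp only [covDeriv_cons]
  exact (hT.fderiv_isAlt hG.isOpen hy u).sub
    ((hT.alt y).derivAction (hG.christoffel_isLinear_right hy u))

theorem covDeriv_isLinear (hG : IsMetricOn G U) (hT : IsFormOn T U) {y : Eu n} (hy : y ∈ U)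
    (w : Fin k → Eu n) : IsLinearMap ℝ (fun u => covDeriv G T y (Fin.cons u w)) := by
  refine isLinearMap_of_lin fun a b p q => ?_
  have hΓ : ∀ x, christoffel G y (a • p + b • q) x
      = a • christoffel G y p x + b • christoffel G y q x := fun x => by
    have := hG.christoffel_isLinear_left hy x
    rw [this.map_add, this.map_smul, this.map_smul]
  simp only [covDeriv_cons, derivAction, hΓ, (hT.alt y).1 w, map_add, map_smul, smul_eq_mul,
    sum_add_distrib, ← mul_sum]
  ring

theorem codiff_isAlt {T : TensorField n (k + 1)} (hG : IsMetricOn G U) (hT : IsFormOn T U)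
    {y : Eu n} (hy : y ∈ U) : IsAlt (codiff G T y) := by
  refine IsAlt.neg (IsAlt.sum fun i _ => IsAlt.sum fun j _ => IsAlt.const_mul ?_ _)
  obtain ⟨h1, h2⟩ := covDeriv_isAlt hG hT hy (e n i)
  refine ⟨fun v s a b x x' => ?_, fun v s t hv hst => ?_⟩
  · simp only [Fin.cons_update (α := fun _ => Eu n) (x := e n j)]
    exact h1 (Fin.cons (e n j) v) s.succ a b x x'
  · exact h2 (Fin.cons (e n j) v) s.succ t.succ (by simpa using hv)
      (fun h => hst (Fin.succ_injective _ h))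

/-- Torsion-freeness: the Christoffel corrections are symmetric in the two arguments they involve,
so the alternating sum kills them. -/
theorem extD_eq_sum_covDeriv {S : TensorField n k} (hG : IsMetricOn G U) {y : Eu n}
    (hS : IsAlt (S y)) (v : Fin (k + 1) → Eu n) :
    extD S y v = ∑ i : Fin (k + 1), (-1 : ℝ) ^ (i : ℕ) *
      covDeriv G S y (Fin.cons (v i) (i.removeNth v)) := by
  have h := hS.alternating_sum_derivAction (hG.christoffel_symm y) v
  simp only [covDeriv_cons, mul_sub, sum_sub_distrib]
  have h' : ∑ i : Fin (k + 1), (-1 : ℝ) ^ (i : ℕ) *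
      derivAction (christoffel G y (v i)) (S y) (i.removeNth v) = 0 := h
  rw [h', sub_zero]
  rfl

/-- Writes "move entry `i` to the front" as a permutation, whose sign is `(-1)^i`. -/
theorem cons_removeNth_eq {V : Type*} (w : Fin (k + 1) → V) (i : Fin (k + 1)) :
    (Fin.cons (w i) (i.removeNth w) : Fin (k + 1) → V) = w ∘ i.cycleRange.symm := by
  ext s
  refine Fin.cases ?_ (fun s => ?_) s
  · simp [Fin.cycleRange_symm_zero]
  · simp [Fin.cycleRange_symm_succ, Fin.removeNth]

theorem derivAction_perm {V : Type*} (L : V → V) (S : (Fin k → V) → ℝ) (w : Fin k → V)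
    (σ : Equiv.Perm (Fin k)) :
    derivAction L S (w ∘ σ) = ∑ s, S (update w s (L (w s)) ∘ σ) := by
  rw [derivAction, ← Equiv.sum_comp σ (fun s => S (update w s (L (w s)) ∘ σ))]
  refine sum_congr rfl fun s _ => ?_
  congr 1
  ext t
  by_cases hts : t = s
  · subst hts; simp
  · simp [hts]

/-- `∇` commutes with alternation: partial derivatives pass through the finite sum, and the
derivation action of `Γ(u, ·)` commutes with permuting the arguments. -/
theorem covDeriv_extD (hG : IsMetricOn G U) (hT : IsFormOn T U) {y : Eu n} (hy : y ∈ U)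
    (u : Eu n) (w : Fin (k + 1) → Eu n) :
    covDeriv G (extD T) y (Fin.cons u w) = ∑ i : Fin (k + 1), (-1 : ℝ) ^ (i : ℕ) *
      covDeriv G (covDeriv G T) y (Fin.cons u (Fin.cons (w i) (i.removeNth w))) := by
  have hd : ∀ v, DifferentiableAt ℝ (fun z => covDeriv G T z v) y := fun v =>
    diffAt_of_contDiffOn hG.isOpen (covDeriv_contDiffOn hG hT v) hy
  have h1 : fderiv ℝ (fun z => extD T z w) y u = ∑ i : Fin (k + 1), (-1 : ℝ) ^ (i : ℕ) *
      fderiv ℝ (fun z => covDeriv G T z (Fin.cons (w i) (i.removeNth w))) y u := by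
    rw [fderiv_congr_of_eqOn hG.isOpen
      (fun z _ => extD_eq_sum_covDeriv hG (hT.alt z) w) hy,
      fderiv_sum_apply (f := fun (i : Fin (k + 1)) z => (-1 : ℝ) ^ (i : ℕ) *
        covDeriv G T z (Fin.cons (w i) (i.removeNth w))) fun i _ => (hd _).const_mul _]
    refine sum_congr rfl fun i _ => ?_
    rw [fderiv_const_mul (hd _)]; simp
  have h2 : derivAction (christoffel G y u) (extD T y) w
      = ∑ i : Fin (k + 1), (-1 : ℝ) ^ (i : ℕ) *
        derivAction (christoffel G y u) (covDeriv G T y)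
          (Fin.cons (w i) (i.removeNth w)) := by
    rw [derivAction]
    simp only [extD_eq_sum_covDeriv hG (hT.alt y), cons_removeNth_eq, derivAction_perm, mul_sum]
    rw [sum_comm]
  rw [covDeriv_cons, h1, h2, ← sum_sub_distrib]
  refine sum_congr rfl fun i _ => ?_
  rw [covDeriv_cons, mul_sub]

theorem codiff_apply {T : TensorField n (k + 1)} (y : Eu n) (w : Fin k → Eu n) :
    codiff G T y w = -∑ i, ∑ j, inv G y i j *
      covDeriv G T y (Fin.cons (e n i) (Fin.cons (e n j) w)) := rfl

/-- `∇` commutes with metric contraction: by `IsMetricOn.sum_fderiv_inv`, the derivative of `g^{ij}`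
supplies exactly the Christoffel terms of the two contracted slots. -/
theorem covDeriv_codiff {T : TensorField n (k + 1)} (hG : IsMetricOn G U) (hT : IsFormOn T U)
    {y : Eu n} (hy : y ∈ U) (u : Eu n) (w : Fin k → Eu n) :
    covDeriv G (codiff G T) y (Fin.cons u w) = -∑ i, ∑ j, inv G y i j *
      covDeriv G (covDeriv G T) y (Fin.cons u (Fin.cons (e n i) (Fin.cons (e n j) w))) := by
  have hd : ∀ v, DifferentiableAt ℝ (fun z => covDeriv G T z v) y := fun v =>
    diffAt_of_contDiffOn hG.isOpen (covDeriv_contDiffOn hG hT v) hy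
  have hdi : ∀ i j, DifferentiableAt ℝ (fun z => inv G z i j) y := fun i j =>
    diffAt_of_contDiffOn hG.isOpen (hG.contDiffOn_inv i j) hy
  have h1 : fderiv ℝ (fun z => codiff G T z w) y u = -∑ i, ∑ j,
      (fderiv ℝ (fun z => inv G z i j) y u *
        covDeriv G T y (Fin.cons (e n i) (Fin.cons (e n j) w))
      + inv G y i j *
        fderiv ℝ (fun z => covDeriv G T z (Fin.cons (e n i) (Fin.cons (e n j) w))) y u) := by
    simp only [codiff_apply]
    rw [fderiv_fun_neg, _root_.neg_apply]
    congr 1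
    rw [fderiv_sum_apply (f := fun i z => ∑ j, inv G z i j *
      covDeriv G T z (Fin.cons (e n i) (Fin.cons (e n j) w)))
      fun i _ => DifferentiableAt.fun_sum fun j _ => (hdi i j).mul (hd _)]
    refine sum_congr rfl fun i _ => ?_
    rw [fderiv_sum_apply (f := fun j z => inv G z i j *
      covDeriv G T z (Fin.cons (e n i) (Fin.cons (e n j) w)))
      fun j _ => (hdi i j).mul (hd _)]
    exact sum_congr rfl fun j _ => fderiv_mul_apply (hdi i j) (hd _) u
  have h2 := hG.sum_fderiv_inv hy u
    (B := fun p q => covDeriv G T y (Fin.cons p (Fin.cons q w)))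
    (fun q => covDeriv_isLinear hG hT hy _)
    (fun p => isLinearMap_of_lin fun a b q q' => by
      have := (covDeriv_isAlt hG hT hy p).1 (Fin.cons 0 w) 0 a b q q'
      simpa only [Fin.update_cons_zero, smul_eq_mul] using this)
  have h3 : ∀ i j, covDeriv G (covDeriv G T) y
      (Fin.cons u (Fin.cons (e n i) (Fin.cons (e n j) w)))
      = fderiv ℝ (fun z => covDeriv G T z (Fin.cons (e n i) (Fin.cons (e n j) w))) y u
        - (covDeriv G T y (Fin.cons (christoffel G y u (e n i)) (Fin.cons (e n j) w))
          + covDeriv G T y (Fin.cons (e n i) (Fin.cons (christoffel G y u (e n j)) w))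
          + ∑ s, covDeriv G T y (Fin.cons (e n i) (Fin.cons (e n j)
              (update w s (christoffel G y u (w s)))))) := by
    intro i j
    rw [covDeriv_cons, derivAction, Fin.sum_univ_succ, Fin.sum_univ_succ]
    simp only [Fin.cons_zero, Fin.cons_succ, Fin.update_cons_zero, ← Fin.cons_update, add_assoc]
  rw [covDeriv_cons, h1, derivAction]
  simp only [codiff_apply, h3, sum_add_distrib, h2, mul_sub, mul_add, sum_sub_distrib,
    sum_neg_distrib]
  have h4 : ∑ s, ∑ i, ∑ j, inv G y i j * covDeriv G T y (Fin.cons (e n i) (Fin.cons (e n j)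
      (update w s (christoffel G y u (w s)))))
      = ∑ i, ∑ j, inv G y i j * ∑ s, covDeriv G T y (Fin.cons (e n i) (Fin.cons (e n j)
      (update w s (christoffel G y u (w s))))) := by
    simp only [mul_sum]
    rw [sum_comm]
    exact sum_congr rfl fun i _ => sum_comm
  rw [h4]
  ring

/-- The terms are grouped so that those symmetric in `u, v` are visible: the second derivative, the
bracketed pair of sums and the `Γ(u, v)` term. Only derivatives of `Γ` and products `ΓΓ` survive
antisymmetrization. -/
theorem second_covDeriv (hG : IsMetricOn G U) (hT : IsFormOn T U) {y : Eu n} (hy : y ∈ U)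
    (u v : Eu n) (w : Fin k → Eu n) :
    covDeriv G (covDeriv G T) y (Fin.cons u (Fin.cons v w))
      = fderiv ℝ (fun z => fderiv ℝ (fun z => T z w) z v) y u
        - (∑ s, fderiv ℝ (fun z => T z (update w s (christoffel G y v (w s)))) y u
          + ∑ s, fderiv ℝ (fun z => T z (update w s (christoffel G y u (w s)))) y v)
        - ∑ s, T y (update w s (fderiv ℝ (fun z => christoffel G z v (w s)) y u))
        - covDeriv G T y (Fin.cons (christoffel G y u v) w)
        + derivAction (christoffel G y u) (derivAction (christoffel G y v) (T y)) w := by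
  have hΓ := fun v s => hT.contDiffOn_update w s (hG.contDiffOn_christoffel v (w s))
  have hd := fun v s => diffAt_of_contDiffOn hG.isOpen (hΓ v s) hy
  rw [covDeriv_cons, derivAction, Fin.sum_univ_succ]
  simp only [Fin.cons_zero, Fin.cons_succ, Fin.update_cons_zero, ← Fin.cons_update]
  simp only [covDeriv_cons]
  have h1 : fderiv ℝ (fun z => fderiv ℝ (fun z => T z w) z v
        - derivAction (christoffel G z v) (T z) w) y u
      = fderiv ℝ (fun z => fderiv ℝ (fun z => T z w) z v) y u
        - ∑ s, (fderiv ℝ (fun z => T z (update w s (christoffel G y v (w s)))) y u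
          + T y (update w s (fderiv ℝ (fun z => christoffel G z v (w s)) y u))) := by
    simp only [derivAction]
    rw [fderiv_sub_apply (g := fun z => ∑ s, T z (update w s (christoffel G z v (w s))))
      (diffAt_of_contDiffOn hG.isOpen
      (contDiffOn_fderiv_apply hG.isOpen (hT.smooth w) v) hy)
      (DifferentiableAt.fun_sum fun s _ => hd v s),
      fderiv_sum_apply (f := fun s z => T z (update w s (christoffel G z v (w s))))
      fun s _ => hd v s]
    congr 1
    exact sum_congr rfl fun s _ =>
      hT.fderiv_update hG.isOpen w s (hG.contDiffOn_christoffel v (w s)) hy u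
  rw [h1]
  simp only [sum_sub_distrib, sum_add_distrib]
  simp only [derivAction]
  ring

/-- The Ricci identity. -/
theorem ricci_identity (hG : IsMetricOn G U) (hT : IsFormOn T U) {y : Eu n} (hy : y ∈ U)
    (u v : Eu n) (w : Fin k → Eu n) :
    covDeriv G (covDeriv G T) y (Fin.cons u (Fin.cons v w))
      - covDeriv G (covDeriv G T) y (Fin.cons v (Fin.cons u w))
      = -derivAction (curvature G y u v) (T y) w := by
  have hsymm : fderiv ℝ (fun z => fderiv ℝ (fun z => T z w) z v) y u
      = fderiv ℝ (fun z => fderiv ℝ (fun z => T z w) z u) y v :=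
    fderiv_fderiv_comm hG.isOpen (hT.smooth w) hy u v
  have hc := derivAction_commutator (T y) (christoffel G y u) (christoffel G y v) w
  rw [second_covDeriv hG hT hy, second_covDeriv hG hT hy, hsymm, hG.christoffel_symm y v u]
  have hM := (hT.alt y).1
  simp only [sum_sub_distrib] at hc
  have h3 : derivAction (curvature G y u v) (T y) w
      = (∑ s, T y (update w s (fderiv ℝ (fun z => christoffel G z v (w s)) y u))
        + ∑ s, T y (update w s (christoffel G y u (christoffel G y v (w s)))))
        - (∑ s, T y (update w s (fderiv ℝ (fun z => christoffel G z u (w s)) y v))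
        + ∑ s, T y (update w s (christoffel G y v (christoffel G y u (w s))))) := by
    simp only [derivAction, curvature, hM.map_update_sub, hM.map_update_add, sum_sub_distrib,
      sum_add_distrib]
  rw [h3]
  linarith

/-- Bringing the front argument back to slot `s` is a cycle of sign `(-1)^s`, which absorbs the sign
from the exterior derivative. -/
theorem neg_one_pow_mul_cons_removeNth {V : Type*} [AddCommGroup V] [Module ℝ V]
    {S : (Fin (k + 1) → V) → ℝ} (hS : IsAlt S) (v : Fin (k + 1) → V) (s : Fin (k + 1)) (c : V) :
    (-1 : ℝ) ^ (s : ℕ) * S (Fin.cons c (s.removeNth v)) = S (update v s c) := by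
  have h1 : (Fin.cons c (s.removeNth v) : Fin (k + 1) → V)
      = update v s c ∘ s.cycleRange.symm := by
    rw [← cons_removeNth_eq]
    simp
  rw [h1, hS.map_perm, Equiv.Perm.sign_symm, Fin.sign_cycleRange, ← mul_assoc]
  push_cast
  rw [← mul_pow]; simp

/-- The Weitzenböck formula. -/
theorem hodge_sub_rough {T : TensorField n (k + 1)} (hG : IsMetricOn G U) (hT : IsFormOn T U)
    {y : Eu n} (hy : y ∈ U) (hR : ∀ u v, IsLinearMap ℝ (curvature G y u v)) (v : Fin (k + 1) → Eu n) :
    Coord.hodgeLaplacian G (k + 1) T y v - Coord.roughLaplacian G T y v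
      = -∑ s, ∑ i, ∑ j, inv G y i j *
          derivAction (curvature G y (e n i) (v s)) (T y) (update v s (e n j)) := by
  have h1 : extD (codiff G T) y v = -∑ s : Fin (k + 1), ∑ i, ∑ j, inv G y i j *
      ((-1 : ℝ) ^ (s : ℕ) * covDeriv G (covDeriv G T) y
        (Fin.cons (v s) (Fin.cons (e n i) (Fin.cons (e n j) (s.removeNth v))))) := by
    rw [extD_eq_sum_covDeriv hG (codiff_isAlt hG hT hy)]
    simp only [covDeriv_codiff hG hT hy, mul_neg, sum_neg_distrib, mul_sum]
    congr 1
    exact sum_congr rfl fun s _ => sum_congr rfl fun i _ => sum_congr rfl fun j _ => by ring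
  have h2 : codiff G (extD T) y v = Coord.roughLaplacian G T y v
      + ∑ s : Fin (k + 1), ∑ i, ∑ j, inv G y i j *
      ((-1 : ℝ) ^ (s : ℕ) * covDeriv G (covDeriv G T) y
        (Fin.cons (e n i) (Fin.cons (v s) (Fin.cons (e n j) (s.removeNth v))))) := by
    have hrough : Coord.roughLaplacian G T y v = -∑ i, ∑ j, inv G y i j *
      covDeriv G (covDeriv G T) y (Fin.cons (e n i) (Fin.cons (e n j) v)) := rfl
    have hrem : ∀ (s : Fin (k + 1)) (c : Eu n),
        (Fin.removeNth s.succ (Fin.cons c v : Fin (k + 2) → Eu n) : Fin (k + 1) → Eu n)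
          = Fin.cons c (s.removeNth v) := by
      intro s c
      ext t : 1
      refine Fin.cases ?_ (fun t => ?_) t <;> simp [Fin.removeNth]
    have hrem0 : ∀ (c : Eu n),
        (Fin.removeNth 0 (Fin.cons c v : Fin (k + 2) → Eu n) : Fin (k + 1) → Eu n) = v := by
      intro c
      ext t : 1
      simp [Fin.removeNth]
    rw [hrough, codiff_apply]
    simp only [covDeriv_extD hG hT hy]
    -- Removing the contracted vector `e_j` (index `0`) yields the rough Laplacian. Removing `v_s`
    -- (index `s + 1`) yields the remaining sum, with one extra sign.
    simp only [Fin.sum_univ_succ (n := k + 1), Fin.cons_zero, Fin.cons_succ, hrem, hrem0,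
      Fin.val_zero, pow_zero, one_mul, Fin.val_succ, pow_succ, mul_add, sum_add_distrib, neg_add]
    congr 1
    simp only [mul_neg, mul_one, neg_mul, sum_neg_distrib, neg_neg, mul_sum]
    conv_rhs => rw [sum_comm]
    refine sum_congr rfl fun i _ => ?_
    conv_rhs => rw [sum_comm]
  have h3 : Coord.hodgeLaplacian G (k + 1) T y v = extD (codiff G T) y v + codiff G (extD T) y v :=
    rfl
  rw [h3, h1, h2, add_sub_assoc, add_sub_cancel_left, ← sub_eq_neg_add, ← sum_sub_distrib,
    ← sum_neg_distrib]
  refine sum_congr rfl fun s _ => ?_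
  rw [← sum_sub_distrib, ← sum_neg_distrib]
  refine sum_congr rfl fun i _ => ?_
  rw [← sum_sub_distrib, ← sum_neg_distrib]
  refine sum_congr rfl fun j _ => ?_
  -- The summands of `dδ` and `δd` differ in the order of the two differentiation slots, so their
  -- difference is a Ricci commutator.
  rw [← neg_one_pow_mul_cons_removeNth ((hT.alt y).derivAction (hR _ _)), ← mul_sub, ← mul_sub,
    ricci_identity hG hT hy]
  ring

end Weitzenbock

/-! ### Linear algebra in a diagonalizing frame -/

theorem exists_conj_diagonal {n : ℕ} {A : Matrix (Fin n) (Fin n) ℝ} (hA : A.IsHermitian) :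
    ∃ Q : Matrix (Fin n) (Fin n) ℝ, Q.transpose * Q = 1 ∧
      Q.transpose * A * Q = Matrix.diagonal hA.eigenvalues := by
  refine ⟨hA.eigenvectorUnitary, ?_, ?_⟩
  · have := Unitary.coe_star_mul_self hA.eigenvectorUnitary
    rwa [Matrix.star_eq_conjTranspose, Matrix.conjTranspose_eq_transpose_of_trivial] at this
  · have := hA.conjStarAlgAut_star_eigenvectorUnitary
    rw [Unitary.conjStarAlgAut_apply] at this
    simpa [Matrix.star_eq_conjTranspose, Matrix.conjTranspose_eq_transpose_of_trivial] using this

/-- Simultaneous diagonalization of a positive definite and a symmetric form. -/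
theorem exists_simultaneous_diagonal {n : ℕ} {A B : Matrix (Fin n) (Fin n) ℝ} (hA : A.PosDef)
    (hB : B.transpose = B) : ∃ (P : Matrix (Fin n) (Fin n) ℝ) (lam : Fin n → ℝ),
      P.transpose * A * P = 1 ∧ P.transpose * B * P = Matrix.diagonal lam := by
  obtain ⟨Q, hQ1, hQ2⟩ := exists_conj_diagonal hA.isHermitian
  set d := hA.isHermitian.eigenvalues with hd
  have hpos : ∀ i, 0 < d i := fun i => hA.eigenvalues_pos i
  -- Rescaling the eigenvectors turns `A` into the identity. The orthogonal matrix that then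
  -- diagonalizes the transformed `B` leaves the identity unchanged.
  set D : Matrix (Fin n) (Fin n) ℝ := Matrix.diagonal fun i => (√(d i))⁻¹ with hD
  have hDt : D.transpose = D := Matrix.diagonal_transpose _
  have h1 : (Q * D).transpose * A * (Q * D) = 1 := by
    have : (Q * D).transpose * A * (Q * D) = D * (Q.transpose * A * Q) * D := by
      rw [Matrix.transpose_mul, hDt]; noncomm_ring
    rw [this, hQ2, hD, Matrix.diagonal_mul_diagonal, Matrix.diagonal_mul_diagonal,
      ← Matrix.diagonal_one]
    congr 1
    ext i
    have hs := Real.sq_sqrt (hpos i).le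
    have hne : √(d i) ≠ 0 := (Real.sqrt_pos.mpr (hpos i)).ne'
    field_simp
    linarith
  have hC : ((Q * D).transpose * B * (Q * D)).IsHermitian := by
    rw [Matrix.IsHermitian, Matrix.conjTranspose_eq_transpose_of_trivial, Matrix.transpose_mul,
      Matrix.transpose_mul _ B, Matrix.transpose_transpose, hB, Matrix.mul_assoc]
  obtain ⟨R, hR1, hR2⟩ := exists_conj_diagonal hC
  refine ⟨Q * D * R, hC.eigenvalues, ?_, ?_⟩
  · have : (Q * D * R).transpose * A * (Q * D * R)
        = R.transpose * ((Q * D).transpose * A * (Q * D)) * R := by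
      rw [Matrix.transpose_mul (Q * D)]; noncomm_ring
    rw [this, h1, Matrix.mul_one, hR1]
  · have : (Q * D * R).transpose * B * (Q * D * R)
        = R.transpose * ((Q * D).transpose * B * (Q * D)) * R := by
      rw [Matrix.transpose_mul (Q * D)]; noncomm_ring
    rw [this, hR2]

/-- `E` is an orthonormal frame for `g`. -/
structure IsOrthoFrame {n : ℕ} (g : Eu n → Eu n → ℝ) (E : Fin n → Eu n) : Prop where
  ortho : ∀ a b, g (E a) (E b) = if a = b then 1 else 0
  inv : ∀ i j, invGram (e n) g i j = ∑ a, E a i * E a j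
  expand : ∀ x, x = ∑ a, g x (E a) • E a

/-- The frame consists of the columns of the simultaneously diagonalizing matrix `P`. From `PᵀAP =
1` follows `A⁻¹ = PPᵀ`, which gives both the formula for the inverse metric and the frame expansion.
-/
theorem IsMetricOn.exists_frame {n : ℕ} {G : MetricField n} {U : Set (Eu n)}
    (hG : IsMetricOn G U) {y : Eu n} (hy : y ∈ U) {h : Eu n → Eu n → ℝ}
    (hl : ∀ w, IsLinearMap ℝ (fun v => h v w)) (hs : ∀ v w, h v w = h w v) :
    ∃ (E : Fin n → Eu n) (lam : Fin n → ℝ), IsOrthoFrame (G y) E ∧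
      ∀ a b, h (E a) (E b) = if a = b then lam a else 0 := by
  set A : Matrix (Fin n) (Fin n) ℝ := Matrix.of fun i j => G y (e n i) (e n j) with hA
  set B : Matrix (Fin n) (Fin n) ℝ := Matrix.of fun i j => h (e n i) (e n j) with hB
  obtain ⟨P, lam, h1, h2⟩ := exists_simultaneous_diagonal (hG.posDef_gram hy) (B := B)
    (by ext i j; simp [hB, hs (e n i) (e n j)])
  have hbil : ∀ (b : Eu n → Eu n → ℝ) (hl : ∀ w, IsLinearMap ℝ (fun v => b v w))
      (hs : ∀ v w, b v w = b w v) (p q : Fin n),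
      b (∑ i, P i p • e n i) (∑ i, P i q • e n i)
        = (P.transpose * (Matrix.of fun i j => b (e n i) (e n j)) * P) p q := by
    intro b hl hs p q
    have hr : ∀ v w, b v (∑ i, P i w • e n i) = ∑ i, P i w • b v (e n i) := by
      intro v w
      rw [hs, isLinearMap_map_sum (hl v)]
      simp only [hs v]
    rw [hr]
    simp only [isLinearMap_map_sum (hl _), Matrix.mul_apply, Matrix.transpose_apply,
      Matrix.of_apply, smul_eq_mul]
    exact sum_congr rfl fun i _ => mul_comm _ _
  have hE : ∀ a i, (∑ i, P i a • e n i : Eu n) i = P i a := by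
    intro a i; simp [e_apply]
  have hPP : A⁻¹ = P * P.transpose := by
    apply Matrix.inv_eq_left_inv
    have := mul_eq_one_comm.mp h1
    rwa [← Matrix.mul_assoc] at this
  refine ⟨fun a => ∑ i, P i a • e n i, lam, ⟨fun a b => ?_, fun i j => ?_, fun x => ?_⟩,
    fun a b => ?_⟩
  · rw [hbil (G y) (hG.isLinear_left y) (hG.symm y), h1, Matrix.one_apply]
  · simp only [hE]
    change A⁻¹ i j = _
    rw [hPP, Matrix.mul_apply]; rfl
  · have hAP : A * (P * P.transpose) = 1 := by
      rw [← hPP]; exact hG.gram_mul_inv hy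
    apply PiLp.ext
    intro l
    have : (∑ a, G y x (∑ i, P i a • e n i) • ∑ i, P i a • e n i : Eu n) l
        = ∑ a, G y x (∑ i, P i a • e n i) * P l a := by
      simp only [WithLp.ofLp_sum, WithLp.ofLp_smul, Finset.sum_apply, Pi.smul_apply, smul_eq_mul,
        e_apply]
      simp
    rw [this]
    have h3 : ∀ m, ∑ i, A m i * ∑ a, P i a * P l a = if m = l then 1 else 0 := by
      intro m
      have := congrFun (congrFun hAP m) l
      rw [Matrix.mul_apply, Matrix.one_apply] at this
      rw [← this]
      exact sum_congr rfl fun i _ => by rw [Matrix.mul_apply]; rfl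
    calc x l = ∑ m, x m * ∑ i, A m i * ∑ a, P i a * P l a := by simp [h3]
      _ = ∑ a, G y x (∑ i, P i a • e n i) * P l a := by
        simp only [hG.sum_right, hG.expand_left y x, mul_sum, sum_mul]
        conv_rhs => rw [sum_comm]; enter [2, i]; rw [sum_comm]
        rw [sum_comm]
        exact sum_congr rfl fun i _ => sum_congr rfl fun m _ => sum_congr rfl fun a _ => by
          simp only [hA, Matrix.of_apply]; ring
  · rw [hbil h hl hs, h2, Matrix.diagonal_apply]

/-! ### Traces and inner products in an orthonormal frame. -/

namespace IsOrthoFrame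

variable {n : ℕ} {g : Eu n → Eu n → ℝ} {E : Fin n → Eu n} (hE : IsOrthoFrame g E)
include hE

theorem sum_inv {B : Eu n → Eu n → ℝ} (hl : ∀ w, IsLinearMap ℝ (fun v => B v w))
    (hr : ∀ v, IsLinearMap ℝ (fun w => B v w)) :
    ∑ i, ∑ j, invGram (e n) g i j * B (e n i) (e n j) = ∑ a, B (E a) (E a) := by
  have h1 : ∀ a, B (E a) (E a) = ∑ i, ∑ j, E a i * E a j * B (e n i) (e n j) := by
    intro a
    conv_lhs => rw [← sum_coord_smul_e (E a)]
    rw [isLinearMap_map_sum (hl _)]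
    refine sum_congr rfl fun i _ => ?_
    rw [isLinearMap_map_sum (hr _), smul_eq_mul, mul_sum]
    exact sum_congr rfl fun j _ => by rw [smul_eq_mul, mul_assoc]
  simp only [h1, hE.inv, sum_mul]
  rw [sum_comm (s := univ (α := Fin n)) (t := univ (α := Fin n))
    (f := fun a i => ∑ j, E a i * E a j * B (e n i) (e n j))]
  exact sum_congr rfl fun i _ => sum_comm

theorem trace_eq {L : Eu n → Eu n} (hL : IsLinearMap ℝ L) (hg : ∀ w, IsLinearMap ℝ (g · w)) :
    ∑ i, L (e n i) i = ∑ a, g (L (E a)) (E a) := by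
  have h1 : ∀ i, L (e n i) i = ∑ a, g (L (e n i)) (E a) * E a i := by
    intro i
    conv_lhs => rw [hE.expand (L (e n i))]
    simp
  have h2 : ∀ a, g (L (E a)) (E a) = ∑ i, E a i * g (L (e n i)) (E a) := by
    intro a
    have : L (E a) = ∑ i, E a i • L (e n i) := by
      conv_lhs => rw [← sum_coord_smul_e (E a)]
      exact isLinearMap_map_sum hL _ _ _
    rw [this, isLinearMap_map_sum (hg (E a))]; rfl
  simp only [h1, h2]
  rw [sum_comm]
  exact sum_congr rfl fun a _ => sum_congr rfl fun i _ => mul_comm _ _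

/-- With `g^{ij} = ∑ a, E_a^i E_a^j`, the product over slots of sums over `a` becomes a sum over
index maps `A`. -/
theorem formInner_eq {k : ℕ} {α β : (Fin k → Eu n) → ℝ} (hα : IsMultilin α) (hβ : IsMultilin β) :
    formInner (e n) g α β
      = ((k.factorial : ℝ))⁻¹ * ∑ A : Fin k → Fin n,
        α (fun s => E (A s)) * β (fun s => E (A s)) := by
  have hx : ∀ {γ : (Fin k → Eu n) → ℝ} (hγ : IsMultilin γ) (A : Fin k → Fin n),
      γ (fun s => E (A s)) = ∑ I : Fin k → Fin n, (∏ s, E (A s) (I s)) * γ (fun s => e n (I s)) := by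
    intro γ hγ A
    have h1 := hγ.toMap.map_sum (fun (s : Fin k) (i : Fin n) => E (A s) i • e n i)
    simp only [sum_coord_smul_e] at h1
    change γ (fun s => E (A s)) = _ at h1
    rw [h1]
    refine sum_congr rfl fun I _ => ?_
    rw [hγ.toMap.map_smul_univ (fun s => E (A s) (I s)) (fun s => e n (I s))]
    rfl
  rw [formInner]
  congr 1
  simp only [hx hα, hx hβ, sum_mul_sum]
  conv_rhs => rw [sum_comm]
  refine sum_congr rfl fun I _ => ?_
  conv_rhs => rw [sum_comm]
  refine sum_congr rfl fun J _ => ?_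
  have : ∏ s, invGram (e n) g (I s) (J s)
      = ∑ A : Fin k → Fin n, (∏ s, E (A s) (I s)) * ∏ s, E (A s) (J s) := by
    simp only [hE.inv, ← prod_mul_distrib]
    rw [Finset.prod_univ_sum]
    simp
  rw [this, sum_mul, sum_mul]
  exact sum_congr rfl fun A _ => by ring

end IsOrthoFrame

/-! ### Spectrum of the curvature term and the pinching inequality. -/

/-- The eigenvalues of the Bochner operator in a diagonalizing frame. -/
theorem IsAlt.sum_derivAction_frame {n k : ℕ} {V : Type*} [AddCommGroup V] [Module ℝ V]
    {m : (Fin k → V) → ℝ} (hm : IsAlt m) {E : Fin n → V} {lam : Fin n → ℝ}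
    {R : V → V → V → V}
    (hR : ∀ a b c, R (E a) (E b) (E c) = (1 + lam a * lam b) •
      ((if b = c then 1 else 0 : ℝ) • E a - (if a = c then 1 else 0 : ℝ) • E b))
    {A : Fin k → Fin n} (hA : Injective A) :
    ∑ s, ∑ a, HypersurfaceBochner.derivAction (R (E a) (E (A s))) m
        (update (fun s => E (A s)) s (E a))
      = -((k * (n - k : ℝ) + (∑ s, lam (A s)) * (∑ a, lam a - ∑ s, lam (A s)))
        * m (fun s => E (A s))) := by
  set w : Fin k → V := fun s => E (A s) with hw
  have key : ∀ s a, HypersurfaceBochner.derivAction (R (E a) (E (A s))) m (update w s (E a))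
      = (∑ t, (if a = A t then 1 else 0 : ℝ)) * (1 + lam a * lam (A s)) * m w
        - (1 + lam a * lam (A s)) * m w := by
    intro s a
    rw [HypersurfaceBochner.derivAction, ← add_sum_erase univ _ (mem_univ s),
      ← add_sum_erase univ (fun t => (if a = A t then 1 else 0 : ℝ)) (mem_univ s)]
    have h1 : m (update (update w s (E a)) s (R (E a) (E (A s)) (update w s (E a) s)))
        = (if a = A s then 1 else 0 : ℝ) * (1 + lam a * lam (A s)) * m w
          - (1 + lam a * lam (A s)) * m w := by
      have hws : update w s (E (A s)) = w := update_eq_self s w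
      rw [update_self, update_idem, hR, hm.1.map_update_smul, hm.1.map_update_sub,
        hm.1.map_update_smul, hm.1.map_update_smul, hws]
      by_cases h : a = A s
      · rw [if_pos h.symm, if_pos rfl, if_pos h, h, hws]; ring
      · rw [if_neg (Ne.symm h), if_pos rfl, if_neg h]; ring
    have h2 : ∀ t ∈ univ.erase s,
        m (update (update w s (E a)) t (R (E a) (E (A s)) (update w s (E a) t)))
        = (if a = A t then 1 else 0 : ℝ) * (1 + lam a * lam (A s)) * m w := by
      intro t ht
      have hts : t ≠ s := ne_of_mem_erase ht
      have hwt : w t = E (A t) := rfl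
      rw [update_of_ne hts, hwt, hR, hm.1.map_update_smul, hm.1.map_update_sub,
        hm.1.map_update_smul, hm.1.map_update_smul, if_neg (hA.ne hts.symm)]
      by_cases h : a = A t
      -- For `a = A t` the vectors in slots `s` and `t` have traded places. The sign of the swap
      -- cancels the minus sign in the curvature.
      · have hsw : update (update w s (E a)) t (E (A s)) = w ∘ Equiv.swap s t := by
          ext r
          by_cases hrt : r = t
          · subst hrt; simp [hw]
          · by_cases hrs : r = s
            · subst hrs; simp [hw, h, hts.symm]
            · simp [hrt, hrs, Equiv.swap_apply_of_ne_of_ne hrs hrt]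
        rw [hsw, hm.map_swap _ hts.symm, if_pos h]; ring
      · rw [if_neg h]; ring
    rw [h1, sum_congr rfl h2, ← sum_mul, ← sum_mul]
    ring
  simp only [key]
  have hd : ∀ t (f : Fin n → ℝ), ∑ a, (if a = A t then 1 else 0 : ℝ) * f a = f (A t) := by
    intro t f; simp
  have h1 : ∀ s, ∑ a, (∑ t, (if a = A t then 1 else 0 : ℝ)) * (1 + lam a * lam (A s))
      = k + (∑ t, lam (A t)) * lam (A s) := by
    intro s
    simp only [sum_mul]
    rw [sum_comm]
    simp only [hd, sum_add_distrib, ← sum_mul]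
    simp
  have h2 : ∀ s, ∑ a, (1 + lam a * lam (A s)) = n + (∑ a, lam a) * lam (A s) := by
    intro s
    simp only [sum_add_distrib, ← sum_mul]
    simp
  -- With `S` the sum over `A` and `T` the full trace, the total is `k² + S² - kn - TS`, the
  -- negative of the claimed eigenvalue.
  simp only [sum_sub_distrib, ← sum_mul, h1, h2]
  simp only [sum_add_distrib, ← mul_sum, sum_const, card_univ, Fintype.card_fin, nsmul_eq_mul]
  ring

/-- The algebraic inequality behind the pinching condition. -/
theorem eigenvalue_nonneg {n k : ℕ} (hk : 2 ≤ k) (hkn : 2 * k ≤ n) (lam : Fin n → ℝ)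
    (hpinch : ∀ b, pinchingBound n k (|∑ a, lam a| / n)
      ≤ (n : ℝ) - 1 + lam b * (∑ a, lam a - lam b)) (A : Fin k → Fin n) :
    0 ≤ k * (n - k : ℝ) + (∑ s, lam (A s)) * (∑ a, lam a - ∑ s, lam (A s)) := by
  -- Changing the sign of all `λ` reverses the unit normal; every quantity involved is even in `λ`.
  wlog hT : 0 ≤ ∑ a, lam a generalizing lam
  · have := this (fun a => -lam a) (fun b => ?_) (by simp only [sum_neg_distrib]; linarith)
    · simp only [sum_neg_distrib] at this
      linarith
    · have := hpinch b
      simp only [sum_neg_distrib, abs_neg]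
      linarith
  set T := ∑ a, lam a with hTdef
  have hk0 : (2 : ℝ) ≤ k := by exact_mod_cast hk
  have hn0 : (2 : ℝ) * k ≤ n := by exact_mod_cast hkn
  set D := √(T ^ 2 + 4 * (k : ℝ) * ((n : ℝ) - k)) with hD
  have hknpos : 0 < (k : ℝ) * ((n : ℝ) - k) := by nlinarith
  have hDsq : D ^ 2 = T ^ 2 + 4 * (k : ℝ) * ((n : ℝ) - k) :=
    Real.sq_sqrt (by nlinarith [sq_nonneg T])
  have hDpos : 0 < D := Real.sqrt_pos.mpr (by nlinarith [sq_nonneg T])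
  have hnH : (n : ℝ) * (|T| / n) = T := by
    rw [abs_of_nonneg hT, mul_div_cancel₀]
    linarith
  -- `p` is the positive root of `k p² - T p - (n - k) = 0`. This makes `p` and `T - p` the roots of
  -- `λ² - Tλ + b - (n - 1)`, so pinching becomes `hquad`.
  set p := (T + D) / (2 * k) with hp
  have hkp : 2 * k * p = T + D := by rw [hp]; field_simp
  have hb : pinchingBound n k (|T| / n)
      = (n : ℝ) * (k - 1) / k + (k - 1) * T * (T + D) / (2 * k ^ 2) := by
    have : (n : ℝ) ^ 2 * (|T| / n) ^ 2 = T ^ 2 := by rw [← mul_pow, hnH]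
    rw [pinchingBound, this, hnH, ← hD]
    congr 1
    have h2 : (n : ℝ) * ((k : ℝ) - 1) * (|T| / n) = (k - 1) * T := by
      rw [mul_right_comm, hnH]; ring
    rw [h2]; ring
  have hquad : ∀ b, (lam b - p) * (lam b - (T - p)) ≤ 0 := by
    intro b
    have h1 := hpinch b
    rw [hb] at h1
    have h2 : p * (T - p) = -((n : ℝ) - 1 - ((n : ℝ) * (k - 1) / k
        + (k - 1) * T * (T + D) / (2 * k ^ 2))) := by
      rw [hp]
      field_simp
      linear_combination (-1) * hDsq
    nlinarith
  -- The order `p < T - p` is impossible: all `λ_b ≥ p` would give `np ≤ T`, whereas `2k ≤ n` gives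
  -- `np ≥ 2kp = T + D > T`.
  rcases lt_or_ge p (T - p) with hlt | hge
  · exfalso
    have h1 : ∀ b, p ≤ lam b := fun b => by
      by_contra hcon
      push Not at hcon
      nlinarith [hquad b, mul_pos (sub_pos.mpr hcon) (sub_pos.mpr (hcon.trans hlt))]
    have h2 : (n : ℝ) * p ≤ T := by
      have := card_nsmul_le_sum univ lam p (fun b _ => h1 b)
      simpa using this
    have hp0 : 0 ≤ p := by positivity
    nlinarith
  · have h1 : ∀ b, lam b ≤ p := fun b => by
      by_contra hcon
      push Not at hcon
      nlinarith [hquad b, mul_pos (sub_pos.mpr hcon) (sub_pos.mpr (hge.trans_lt hcon))]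
    have h2 : ∀ b, T - p ≤ lam b := fun b => by
      by_contra hcon
      push Not at hcon
      nlinarith [hquad b, mul_pos (sub_pos.mpr hcon) (sub_pos.mpr (hcon.trans_le hge))]
    set S := ∑ s, lam (A s) with hS
    have h3 : S ≤ k * p := by
      have := sum_le_card_nsmul univ (fun s => lam (A s)) p (fun s _ => h1 _)
      simpa using this
    have h4 : k * (T - p) ≤ S := by
      have := card_nsmul_le_sum univ (fun s => lam (A s)) (T - p) (fun s _ => h2 _)
      simpa using this
    have h5 : (T + D) / 2 - S ≥ 0 := by linarith
    -- Here `k(T - p) = (T - D)/2 + (k - 1)T`, and the last term is nonnegative.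
    have h6 : S - (T - D) / 2 ≥ 0 := by nlinarith
    -- The product of the two factors equals `k(n - k) + S(T - S)`.
    nlinarith [mul_nonneg h5 h6]

/-! ### The pointwise estimate -/

/-- `R` is the curvature of a hypersurface of the unit sphere with second fundamental form `h`. -/
def IsGaussCurvature {V : Type*} (g h : V → V → ℝ) (R : V → V → V → V) : Prop :=
  ∀ u v w x, g (R u v w) x = g v w * g u x - g u w * g v x + (h v w * h u x - h u w * h v x)

section Pointwise

variable {n : ℕ} {G : MetricField n} {U : Set (Eu n)} {y : Eu n} {h : Eu n → Eu n → ℝ}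
  {R : Eu n → Eu n → Eu n → Eu n}

/-- Linearity of the curvature in each argument is read off from the Gauss formula and nondegeneracy
of the metric, with no computation with derivatives of `Γ`. -/
theorem IsGaussCurvature.isLinear_first (hR : IsGaussCurvature (G y) h R) (hG : IsMetricOn G U)
    (hy : y ∈ U) (hl : ∀ w, IsLinearMap ℝ (fun v => h v w)) (v w : Eu n) :
    IsLinearMap ℝ (fun u => R u v w) := by
  refine isLinearMap_of_lin fun a b p q => hG.ext_of_inner hy fun x => ?_
  rw [hG.lin, hR, hR, hR, hG.lin, hG.lin]
  simp only [(hl _).map_add, (hl _).map_smul, smul_eq_mul]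
  ring

theorem IsGaussCurvature.isLinear_second (hR : IsGaussCurvature (G y) h R) (hG : IsMetricOn G U)
    (hy : y ∈ U) (hl : ∀ w, IsLinearMap ℝ (fun v => h v w)) (u w : Eu n) :
    IsLinearMap ℝ (fun v => R u v w) := by
  refine isLinearMap_of_lin fun a b p q => hG.ext_of_inner hy fun x => ?_
  rw [hG.lin, hR, hR, hR, hG.lin, hG.lin]
  simp only [(hl _).map_add, (hl _).map_smul, smul_eq_mul]
  ring

theorem IsGaussCurvature.isLinear_third (hR : IsGaussCurvature (G y) h R) (hG : IsMetricOn G U)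
    (hy : y ∈ U) (hl : ∀ w, IsLinearMap ℝ (fun v => h v w)) (hs : ∀ v w, h v w = h w v)
    (u v : Eu n) : IsLinearMap ℝ (R u v) := by
  refine isLinearMap_of_lin fun a b p q => hG.ext_of_inner hy fun x => ?_
  rw [hG.lin, hR, hR, hR, hG.lin_right, hG.lin_right, hs v (_ + _), hs u (_ + _)]
  simp only [(hl _).map_add, (hl _).map_smul, smul_eq_mul, hs _ v, hs _ u]
  ring

theorem IsGaussCurvature.frame (hR : IsGaussCurvature (G y) h R) {E : Fin n → Eu n}
    {lam : Fin n → ℝ} (hE : IsOrthoFrame (G y) E)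
    (hh : ∀ a b, h (E a) (E b) = if a = b then lam a else 0) (a b c : Fin n) :
    R (E a) (E b) (E c) = (1 + lam a * lam b) •
      ((if b = c then 1 else 0 : ℝ) • E a - (if a = c then 1 else 0 : ℝ) • E b) := by
  rw [hE.expand (R (E a) (E b) (E c))]
  simp only [hR (E a) (E b) (E c), hE.ortho, hh]
  have : ∀ d, ((if b = c then 1 else 0 : ℝ) * (if a = d then 1 else 0)
      - (if a = c then 1 else 0) * (if b = d then 1 else 0)
      + ((if b = c then lam b else 0) * (if a = d then lam a else 0)
      - (if a = c then lam a else 0) * (if b = d then lam b else 0))) • E d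
      = (if a = d then ((1 + lam a * lam b) * (if b = c then 1 else 0)) • E a else 0)
        - (if b = d then ((1 + lam a * lam b) * (if a = c then 1 else 0)) • E b else 0) := by
    intro d
    by_cases h1 : a = d <;> by_cases h2 : b = d
    · subst h1; subst h2; simp
    · subst h1; simp only [if_true, if_neg h2]
      split_ifs <;> module
    · subst h2; simp only [if_true, if_neg h1]
      split_ifs <;> module
    · simp only [if_neg h1, if_neg h2]
      split_ifs <;> module
  simp only [this, sum_sub_distrib, sum_ite_eq, mem_univ, if_true]
  module

/-- The curvature term of the Weitzenböck formula. -/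
def weitzenbockTerm {k : ℕ} (g : Eu n → Eu n → ℝ) (R : Eu n → Eu n → Eu n → Eu n)
    (m : (Fin k → Eu n) → ℝ) (v : Fin k → Eu n) : ℝ :=
  -∑ s, ∑ i, ∑ j, invGram (e n) g i j * derivAction (R (e n i) (v s)) m (update v s (e n j))

theorem weitzenbockTerm_isMultilin {k : ℕ} (hR : IsGaussCurvature (G y) h R)
    (hG : IsMetricOn G U) (hy : y ∈ U) (hl : ∀ w, IsLinearMap ℝ (fun v => h v w))
    (hs : ∀ v w, h v w = h w v) {m : (Fin k → Eu n) → ℝ} (hm : IsMultilin m) :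
    IsMultilin (weitzenbockTerm (G y) R m) := by
  refine IsMultilin.neg (IsMultilin.sum fun s _ => IsMultilin.sum fun i _ =>
    IsMultilin.sum fun j _ => IsMultilin.const_mul ?_ _)
  have hR3 := hR.isLinear_third hG hy hl hs
  intro v r a b x x'
  by_cases hrs : r = s
  · subst hrs
    have hR2 : ∀ w, R (e n i) (a • x + b • x') w = a • R (e n i) x w + b • R (e n i) x' w := by
      intro w
      have := hR.isLinear_second hG hy hl (e n i) w
      rw [this.map_add, this.map_smul, this.map_smul]
    simp only [update_self, update_idem, derivAction, hR2, hm _ _ a b, sum_add_distrib, mul_sum]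
  · have h1 : ∀ z, update v r z s = v s := fun z => update_of_ne (Ne.symm hrs) _ _
    simp only [h1, update_comm hrs]
    exact hm.derivAction (hR3 (e n i) (v s)) _ r a b x x'

/-- In the diagonalizing frame the pairing is `1/k!` times a sum over index maps `A` of eigenvalue
times `m(E_A)²`. Maps with a repeated index contribute zero, and the others are handled by
`eigenvalue_nonneg`. -/
theorem weitzenbockTerm_nonneg {k : ℕ} (hk : 2 ≤ k) (hkn : 2 * k ≤ n)
    (hR : IsGaussCurvature (G y) h R)
    (hG : IsMetricOn G U) (hy : y ∈ U) (hl : ∀ w, IsLinearMap ℝ (fun v => h v w))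
    (hs : ∀ v w, h v w = h w v) {m : (Fin k → Eu n) → ℝ} (hm : IsAlt m)
    (hpinch : ∀ v, G y v v = 1 → pinchingBound n k
      (|∑ i, ∑ j, invGram (e n) (G y) i j * h (e n i) (e n j)| / n) ≤ ∑ i, R (e n i) v v i) :
    0 ≤ formInner (e n) (G y) (weitzenbockTerm (G y) R m) m := by
  obtain ⟨E, lam, hE, hh⟩ := hG.exists_frame hy hl hs
  have hr : ∀ v, IsLinearMap ℝ (fun w => h v w) := fun v => by simpa only [hs v] using hl v
  have hH : ∑ i, ∑ j, invGram (e n) (G y) i j * h (e n i) (e n j) = ∑ a, lam a := by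
    rw [hE.sum_inv hl hr]; simp [hh]
  have hric : ∀ b, ∑ i, R (e n i) (E b) (E b) i
      = (n : ℝ) - 1 + lam b * (∑ a, lam a - lam b) := by
    intro b
    rw [hE.trace_eq (hR.isLinear_first hG hy hl _ _) (hG.isLinear_left y)]
    have h1 : ∀ a, G y (R (E a) (E b) (E b)) (E a)
        = (1 + lam b * lam a) - (if a = b then 1 + lam b * lam a else 0) := by
      intro a
      rw [hR, hE.ortho, hE.ortho, hE.ortho, hE.ortho, hh, hh, hh, hh]
      by_cases hab : a = b
      · subst hab; simp
      · simp [hab]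
    simp only [h1, sum_sub_distrib, sum_add_distrib, ← mul_sum, sum_ite_eq', mem_univ, if_true,
      sum_const, card_univ, Fintype.card_fin, nsmul_eq_mul]
    ring
  have hpinch' : ∀ b, pinchingBound n k (|∑ a, lam a| / n)
      ≤ (n : ℝ) - 1 + lam b * (∑ a, lam a - lam b) := by
    intro b
    have := hpinch (E b) (by rw [hE.ortho, if_pos rfl])
    rwa [hH, hric] at this
  rw [hE.formInner_eq (weitzenbockTerm_isMultilin hR hG hy hl hs hm.1) hm.1]
  refine mul_nonneg (by positivity) (sum_nonneg fun A _ => ?_)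
  by_cases hA : Injective A
  · have h1 : weitzenbockTerm (G y) R m (fun s => E (A s))
        = (k * (n - k : ℝ) + (∑ s, lam (A s)) * (∑ a, lam a - ∑ s, lam (A s)))
          * m (fun s => E (A s)) := by
      rw [weitzenbockTerm, neg_eq_iff_eq_neg, ← hm.sum_derivAction_frame (hR.frame hE hh) hA]
      refine sum_congr rfl fun s _ => ?_
      refine hE.sum_inv (B := fun p q => derivAction (R p (E (A s))) m
        (update (fun s => E (A s)) s q)) (fun q => ?_) (fun p => ?_)
      · refine isLinearMap_of_lin fun a b p p' => ?_
        have hR1 : ∀ w, R (a • p + b • p') (E (A s)) w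
            = a • R p (E (A s)) w + b • R p' (E (A s)) w := by
          intro w
          have := hR.isLinear_first hG hy hl (E (A s)) w
          rw [this.map_add, this.map_smul, this.map_smul]
        simp only [derivAction, hR1, hm.1 _ _ a b, sum_add_distrib, mul_sum, smul_eq_mul]
      · exact isLinearMap_of_lin fun a b q q' =>
          hm.1.derivAction (hR.isLinear_third hG hy hl hs p (E (A s))) _ s a b q q'
    rw [h1, mul_assoc]
    exact mul_nonneg (eigenvalue_nonneg hk hkn lam hpinch' A) (mul_self_nonneg _)
  · simp only [Injective, not_forall] at hA
    obtain ⟨i, j, hij, hne⟩ := hA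
    rw [hm.2 _ i j (by simp [hij]) hne, mul_zero]

end Pointwise

/-! ### The Gauss equation -/

section Gauss

variable {n : ℕ} {G : MetricField n} {U : Set (Eu n)} {N : Type*} [NormedAddCommGroup N]
  [InnerProductSpace ℝ N] {F : Eu n → N}

open Coord

theorem fderiv_inner_of_contDiffOn (hU : IsOpen U) {p q : Eu n → N} (hp : ContDiffOn ℝ ∞ p U)
    (hq : ContDiffOn ℝ ∞ q U) {y : Eu n} (hy : y ∈ U) (u : Eu n) :
    fderiv ℝ (fun z => ⟪p z, q z⟫) y u = ⟪p y, fderiv ℝ q y u⟫ + ⟪fderiv ℝ p y u, q y⟫ :=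
  fderiv_inner_apply ℝ (diffAt_of_contDiffOn hU hp hy) (diffAt_of_contDiffOn hU hq hy) u

/-- The tangential part of the second derivative is the Levi-Civita connection. -/
theorem inner_fderiv_christoffel (hG : IsMetricOn G U) (hF : ContDiffOn ℝ ∞ F U)
    (hGF : ∀ y ∈ U, ∀ u v, G y u v = ⟪fderiv ℝ F y u, fderiv ℝ F y v⟫) {y : Eu n} (hy : y ∈ U)
    (u v w : Eu n) :
    G y (christoffel G y u v) w
      = ⟪fderiv ℝ (fun z => fderiv ℝ F z v) y u, fderiv ℝ F y w⟫ := by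
  have hd := fun v => contDiffOn_fderiv_apply hG.isOpen hF v
  have h1 : ∀ u v w, fderiv ℝ (fun z => G z v w) y u
      = ⟪fderiv ℝ F y v, fderiv ℝ (fun z => fderiv ℝ F z w) y u⟫
        + ⟪fderiv ℝ (fun z => fderiv ℝ F z v) y u, fderiv ℝ F y w⟫ := by
    intro u v w
    rw [fderiv_congr_of_eqOn hG.isOpen (fun z hz => hGF z hz v w) hy]
    exact fderiv_inner_of_contDiffOn hG.isOpen (hd v) (hd w) hy u
  -- The Koszul expression has six terms; by symmetry of second derivatives four cancel and two
  -- coincide.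
  rw [hG.inner_christoffel hy, h1, h1, h1, fderiv_fderiv_comm hG.isOpen hF hy v u,
    fderiv_fderiv_comm hG.isOpen hF hy w u, fderiv_fderiv_comm hG.isOpen hF hy w v,
    real_inner_comm (fderiv ℝ F y v)]
  ring

theorem IsMetricOn.fderiv_apply_left (hG : IsMetricOn G U) {c : Eu n → Eu n}
    (hc : ContDiffOn ℝ ∞ c U) {y : Eu n} (hy : y ∈ U) (u x : Eu n) :
    fderiv ℝ (fun z => G z (c z) x) y u
      = fderiv ℝ (fun z => G z (c y) x) y u + G y (fderiv ℝ c y u) x := by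
  have hci : ∀ i, DifferentiableAt ℝ (fun z => c z i) y := fun i =>
    diffAt_of_contDiffOn hG.isOpen (contDiffOn_coord hc i) hy
  have h1 : fderiv ℝ (fun z => G z (c z) x) y u
      = ∑ i, ((fderiv ℝ c y u) i * G y (e n i) x
        + c y i * fderiv ℝ (fun z => G z (e n i) x) y u) := by
    simp only [hG.expand_left _ (c _) x]
    rw [fderiv_sum_apply (f := fun i z => c z i * G z (e n i) x)
      fun i _ => (hci i).mul (hG.diffAt hy _ _)]
    refine sum_congr rfl fun i _ => ?_
    rw [fderiv_mul_apply (hci i) (hG.diffAt hy _ _),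
      fderiv_coord (diffAt_of_contDiffOn hG.isOpen hc hy)]
  have h2 : fderiv ℝ (fun z => G z (c y) x) y u
      = ∑ i, c y i * fderiv ℝ (fun z => G z (e n i) x) y u := by
    simp only [hG.expand_left _ (c _) x]
    rw [fderiv_sum_apply (f := fun i z => c y i * G z (e n i) x)
      fun i _ => (hG.diffAt hy _ _).const_mul _]
    refine sum_congr rfl fun i _ => ?_
    rw [fderiv_const_mul (hG.diffAt hy _ _)]; simp
  rw [h1, h2, hG.expand_left y (fderiv ℝ c y u), sum_add_distrib, add_comm]

/-- The Gauss equation for an isometric immersion into a Euclidean space. -/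
theorem gauss_equation (hG : IsMetricOn G U) (hF : ContDiffOn ℝ ∞ F U)
    (hGF : ∀ y ∈ U, ∀ u v, G y u v = ⟪fderiv ℝ F y u, fderiv ℝ F y v⟫) {y : Eu n} (hy : y ∈ U)
    (u v w x : Eu n) :
    G y (curvature G y u v w) x
      = (⟪fderiv ℝ (fun z => fderiv ℝ F z w) y v, fderiv ℝ (fun z => fderiv ℝ F z x) y u⟫
          - G y (christoffel G y v w) (christoffel G y u x))
        - (⟪fderiv ℝ (fun z => fderiv ℝ F z w) y u, fderiv ℝ (fun z => fderiv ℝ F z x) y v⟫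
          - G y (christoffel G y u w) (christoffel G y v x)) := by
  have hd := fun v => contDiffOn_fderiv_apply hG.isOpen hF v
  have hdd := fun v w => contDiffOn_fderiv_apply hG.isOpen (hd w) v
  -- Obtained by differentiating `G(Γ(v, w), x) = ⟪∂_v ∂_w F, ∂_x F⟫` along `u`. The
  -- third-derivative term is symmetric in `u, v` and drops out of the curvature.
  have key : ∀ u v, G y (fderiv ℝ (fun z => christoffel G z v w) y u
        + christoffel G y u (christoffel G y v w)) x
      = ⟪fderiv ℝ (fun z => fderiv ℝ (fun z => fderiv ℝ F z w) z v) y u, fderiv ℝ F y x⟫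
        + ⟪fderiv ℝ (fun z => fderiv ℝ F z w) y v, fderiv ℝ (fun z => fderiv ℝ F z x) y u⟫
        - G y (christoffel G y v w) (christoffel G y u x) := by
    intro u v
    have h1 := congrArg (fun L => L u) (fderiv_congr_of_eqOn hG.isOpen
      (fun z hz => inner_fderiv_christoffel hG hF hGF hz v w x) hy)
    rw [hG.fderiv_apply_left (hG.contDiffOn_christoffel v w) hy, hG.fderiv_metric hy,
      fderiv_inner_of_contDiffOn hG.isOpen (hdd v w) (hd x) hy] at h1
    have h2 := hG.lin y 1 1 (fderiv ℝ (fun z => christoffel G z v w) y u)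
      (christoffel G y u (christoffel G y v w)) x
    simp only [one_smul, one_mul] at h2
    rw [h2]
    linarith
  have hsub := hG.lin y 1 (-1) (fderiv ℝ (fun z => christoffel G z v w) y u
        + christoffel G y u (christoffel G y v w)) (fderiv ℝ (fun z => christoffel G z u w) y v
        + christoffel G y v (christoffel G y u w)) x
  have hc : curvature G y u v w = (1 : ℝ) • (fderiv ℝ (fun z => christoffel G z v w) y u
        + christoffel G y u (christoffel G y v w))
        + (-1 : ℝ) • (fderiv ℝ (fun z => christoffel G z u w) y v
        + christoffel G y v (christoffel G y u w)) := by
    rw [curvature]; module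
  rw [hc, hsub, key u v, key v u, fderiv_fderiv_comm hG.isOpen (hd w) hy v u]
  ring

/-- The Gauss equation for a hypersurface of the unit sphere. -/
theorem isGaussCurvature_of_sphere (hG : IsMetricOn G U) (hF : ContDiffOn ℝ ∞ F U)
    (hGF : ∀ y ∈ U, ∀ u v, G y u v = ⟪fderiv ℝ F y u, fderiv ℝ F y v⟫)
    (hsph : ∀ y ∈ U, ⟪F y, F y⟫ = (1 : ℝ)) {y : Eu n} (hy : y ∈ U) {ξ : N}
    (hξF : ⟪ξ, F y⟫ = (0 : ℝ)) (hξd : ∀ v, ⟪ξ, fderiv ℝ F y v⟫ = (0 : ℝ))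
    (hspan : ∀ q : N, ⟪F y, q⟫ = (0 : ℝ) → (∀ v, ⟪fderiv ℝ F y v, q⟫ = (0 : ℝ)) →
      q = (⟪ξ, q⟫ : ℝ) • ξ) :
    IsGaussCurvature (G y) (fun u v => ⟪ξ, fderiv ℝ (fun z => fderiv ℝ F z v) y u⟫)
      (curvature G y) := by
  have hd := fun v => contDiffOn_fderiv_apply hG.isOpen hF v
  have hperp : ∀ z ∈ U, ∀ v, ⟪F z, fderiv ℝ F z v⟫ = (0 : ℝ) := by
    intro z hz v
    have h1 := congrArg (fun L => L v) (fderiv_congr_of_eqOn hG.isOpen hsph hz)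
    rw [fderiv_inner_of_contDiffOn hG.isOpen hF hF hz, real_inner_comm (F z)] at h1
    simp only [fderiv_fun_const, Pi.zero_apply, _root_.zero_apply] at h1
    linarith
  -- The position component of the second derivative, from differentiating `⟪F, ∂_v F⟫ = 0`. It
  -- produces the constant-curvature-one part of the Gauss equation.
  have hsecond : ∀ u v, ⟪F y, fderiv ℝ (fun z => fderiv ℝ F z v) y u⟫ = -G y u v := by
    intro u v
    have h1 := congrArg (fun L => L u)
      (fderiv_congr_of_eqOn hG.isOpen (fun z hz => hperp z hz v) hy)
    rw [fderiv_inner_of_contDiffOn hG.isOpen hF (hd v) hy] at h1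
    simp only [fderiv_fun_const, Pi.zero_apply, _root_.zero_apply] at h1
    rw [hGF y hy]
    linarith
  have htan := fun u v w => inner_fderiv_christoffel hG hF hGF hy u v w
  -- Splitting into tangential, position and normal parts: after the first two are removed, the rest
  -- is orthogonal to `F` and to the tangent vectors, so `hspan` applies.
  have hdecomp : ∀ u v, fderiv ℝ (fun z => fderiv ℝ F z v) y u
      = fderiv ℝ F y (christoffel G y u v) + (-G y u v) • F y
        + (⟪ξ, fderiv ℝ (fun z => fderiv ℝ F z v) y u⟫ : ℝ) • ξ := by
    intro u v
    have h1 := hspan (fderiv ℝ (fun z => fderiv ℝ F z v) y u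
      - fderiv ℝ F y (christoffel G y u v) + (G y u v) • F y) ?_ ?_
    · have h2 : (⟪ξ, fderiv ℝ (fun z => fderiv ℝ F z v) y u
          - fderiv ℝ F y (christoffel G y u v) + (G y u v) • F y⟫ : ℝ)
          = ⟪ξ, fderiv ℝ (fun z => fderiv ℝ F z v) y u⟫ := by
        rw [inner_add_right, inner_sub_right, inner_smul_right, hξd, hξF]; ring
      rw [h2] at h1
      rw [← h1]
      module
    · rw [inner_add_right, inner_sub_right, inner_smul_right, hsecond, hperp y hy, hsph y hy]
      ring
    · intro x
      rw [inner_add_right, inner_sub_right, inner_smul_right, real_inner_comm, ← htan,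
        ← hGF y hy, real_inner_comm, hperp y hy, hG.symm y x]
      ring
  intro u v w x
  have hII : ∀ a b c d, ⟪fderiv ℝ (fun z => fderiv ℝ F z b) y a,
      fderiv ℝ (fun z => fderiv ℝ F z d) y c⟫ - G y (christoffel G y a b) (christoffel G y c d)
      = G y a b * G y c d + ⟪ξ, fderiv ℝ (fun z => fderiv ℝ F z b) y a⟫
        * ⟪ξ, fderiv ℝ (fun z => fderiv ℝ F z d) y c⟫ := by
    intro a b c d
    have h1 : (⟪fderiv ℝ (fun z => fderiv ℝ F z b) y a,
        fderiv ℝ (fun z => fderiv ℝ F z d) y c⟫ : ℝ)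
        = ⟪fderiv ℝ (fun z => fderiv ℝ F z b) y a, fderiv ℝ F y (christoffel G y c d)
          + (-G y c d) • F y + (⟪ξ, fderiv ℝ (fun z => fderiv ℝ F z d) y c⟫ : ℝ) • ξ⟫ := by
      rw [← hdecomp c d]
    rw [h1, inner_add_right, inner_add_right, inner_smul_right, inner_smul_right, ← htan,
      real_inner_comm (F y), hsecond, real_inner_comm ξ]
    ring
  rw [gauss_equation hG hF hGF hy, hII, hII]
  ring

end Gauss

/-! ### Passage to the preferred chart -/

section Chart

variable {n : ℕ} {M : Type*} [TopologicalSpace M] [ChartedSpace (Eu n) M]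

theorem isOpen_chartTarget (x : M) : IsOpen (extChartAt (𝓡 n) x).target :=
  isOpen_extChartAt_target x

theorem chartSymmDeriv_eq_within (x : M) (y : Eu n) :
    chartSymmDeriv (n := n) x y = mfderivWithin 𝓘(ℝ, EuclideanSpace ℝ (Fin n)) (𝓡 n)
      (extChartAt (𝓡 n) x).symm (Set.range (𝓡 n)) y := by
  rw [ModelWithCorners.range_eq_univ, mfderivWithin_univ]
  rfl

theorem isFormOn_chartForm {k : ℕ} {η : DiffForm n M k} (hη : IsSmoothForm η) (x : M) :
    IsFormOn (chartForm η x) (extChartAt (𝓡 n) x).target := by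
  refine ⟨fun y => ⟨fun v i a b u w => ?_, fun v i j hv hij => ?_⟩, hη x⟩
  · set m := (η ((extChartAt (𝓡 n) x).symm y)).compLinearMap
      (chartSymmDeriv x y).toLinearMap with hm
    change m _ = a * m _ + b * m _
    rw [m.map_update_add, m.map_update_smul, m.map_update_smul]
    rfl
  · exact (η ((extChartAt (𝓡 n) x).symm y)).map_eq_zero_of_eq _
      (congrArg (chartSymmDeriv x y) hv) hij

/-- The immersion in the preferred chart. -/
def chartMap (f : M → Metric.sphere (0 : EuclideanSpace ℝ (Fin (n + 2))) 1) (x : M)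
    (z : Eu n) : EuclideanSpace ℝ (Fin (n + 2)) :=
  f ((extChartAt (𝓡 n) x).symm z)

theorem chartMap_self (f : M → Metric.sphere (0 : EuclideanSpace ℝ (Fin (n + 2))) 1) (x : M) :
    chartMap f x (extChartAt (𝓡 n) x x) = f x := by
  rw [chartMap, extChartAt_to_inv]

theorem inner_chartMap_self (f : M → Metric.sphere (0 : EuclideanSpace ℝ (Fin (n + 2))) 1) (x : M)
    (y : Eu n) : ⟪chartMap f x y, chartMap f x y⟫ = (1 : ℝ) := by
  rw [real_inner_self_eq_norm_sq, chartMap, norm_eq_of_mem_sphere]; norm_num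

variable [IsManifold (𝓡 n) ∞ M]

/-- `T_x M` is identified with `ℝⁿ` through the preferred chart at `x`, so that chart's differential
at `x` is the identity. -/
theorem chartDeriv_apply (x : M) (v : Eu n) : chartDeriv (n := n) x v = v := by
  have : IsManifold (𝓡 n) 1 M := IsManifold.of_le (n := ∞) (by simp)
  have h := mfderiv_extChartAt_self (I := 𝓡 n) (x := x)
  exact congrArg (fun L : Eu n →L[ℝ] Eu n => L v) h

theorem chartSymmDeriv_self (x : M) (v : Eu n) :
    (chartSymmDeriv (n := n) x (extChartAt (𝓡 n) x x) v : Eu n) = v := by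
  have : IsManifold (𝓡 n) 1 M := IsManifold.of_le (n := ∞) (by simp)
  have h := mfderivWithin_range_extChartAt_symm (I := 𝓡 n) (x := x)
  rw [← chartSymmDeriv_eq_within] at h
  exact congrArg (fun L : Eu n →L[ℝ] Eu n => L v) h

theorem chartSymmDeriv_injective (x : M) {y : Eu n} (hy : y ∈ (extChartAt (𝓡 n) x).target) :
    Injective (chartSymmDeriv (n := n) x y) := by
  have : IsManifold (𝓡 n) 1 M := IsManifold.of_le (n := ∞) (by simp)
  rw [chartSymmDeriv_eq_within]
  exact (isInvertible_mfderivWithin_extChartAt_symm hy).injective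

theorem chartForm_self {k : ℕ} (η : DiffForm n M k) (x : M) (v : Fin k → Eu n) :
    chartForm η x (extChartAt (𝓡 n) x x) v = η x v := by
  have h1 : ∀ p : M, p = x → η p v = η x v := by rintro p rfl; rfl
  have h2 : (fun s => (chartSymmDeriv (n := n) x (extChartAt (𝓡 n) x x) (v s) : Eu n)) = v :=
    funext fun s => chartSymmDeriv_self x (v s)
  rw [← h1 _ (extChartAt_to_inv (I := 𝓡 n) x)]
  exact congrArg (fun w : Fin k → Eu n =>
    η ((extChartAt (𝓡 n) x).symm (extChartAt (𝓡 n) x x)) w) h2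

theorem chartMetric_self (g : RiemMetric n M) (x : M) (u v : Eu n) :
    chartMetric g x (extChartAt (𝓡 n) x x) u v = RiemMetric.at g x u v := by
  have h1 : ∀ p : M, p = x → RiemMetric.at g p u v = RiemMetric.at g x u v := by
    rintro p rfl; rfl
  rw [← h1 _ (extChartAt_to_inv (I := 𝓡 n) x)]
  exact congrArg₂ (fun a b : Eu n =>
    RiemMetric.at g ((extChartAt (𝓡 n) x).symm (extChartAt (𝓡 n) x x)) a b)
    (chartSymmDeriv_self x u) (chartSymmDeriv_self x v)

variable {g : RiemMetric n M} {f : M → Metric.sphere (0 : EuclideanSpace ℝ (Fin (n + 2))) 1}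

theorem IsIsometricImmersion.contMDiff_coe (hf : IsIsometricImmersion g f) :
    ContMDiff (𝓡 n) 𝓘(ℝ, EuclideanSpace ℝ (Fin (n + 2))) ∞
      (fun p => (f p : EuclideanSpace ℝ (Fin (n + 2)))) :=
  haveI : Fact (Module.finrank ℝ (EuclideanSpace ℝ (Fin (n + 2))) = n + 1 + 1) :=
    ⟨by simp⟩
  contMDiff_coe_sphere.comp hf.1

theorem IsIsometricImmersion.contDiffOn_chartMap (hf : IsIsometricImmersion g f) (x : M) :
    ContDiffOn ℝ ∞ (chartMap f x) (extChartAt (𝓡 n) x).target := by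
  rw [← contMDiffOn_iff_contDiffOn]
  exact hf.contMDiff_coe.comp_contMDiffOn (contMDiffOn_extChartAt_symm x)

theorem IsIsometricImmersion.fderiv_chartMap (hf : IsIsometricImmersion g f) (x : M) {y : Eu n}
    (hy : y ∈ (extChartAt (𝓡 n) x).target) (v : Eu n) :
    fderiv ℝ (chartMap f x) y v
      = ambientDeriv f ((extChartAt (𝓡 n) x).symm y) (chartSymmDeriv x y v) := by
  have : IsManifold (𝓡 n) 1 M := IsManifold.of_le (n := ∞) (by simp)
  have h1 : MDifferentiableAt 𝓘(ℝ, Eu n) (𝓡 n) (extChartAt (𝓡 n) x).symm y :=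
    ((contMDiffOn_extChartAt_symm (n := ∞) x).contMDiffAt
      ((isOpen_chartTarget x).mem_nhds hy)).mdifferentiableAt (by simp)
  have h2 := mfderiv_comp y (hf.contMDiff_coe.mdifferentiable (by simp) _) h1
  rw [← mfderiv_eq_fderiv]
  exact congrArg (fun L : Eu n →L[ℝ] EuclideanSpace ℝ (Fin (n + 2)) => L v) h2

theorem IsIsometricImmersion.chartMetric_eq (hf : IsIsometricImmersion g f) (x : M) {y : Eu n}
    (hy : y ∈ (extChartAt (𝓡 n) x).target) (u v : Eu n) :
    chartMetric g x y u v = ⟪fderiv ℝ (chartMap f x) y u, fderiv ℝ (chartMap f x) y v⟫ := by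
  rw [hf.fderiv_chartMap x hy, hf.fderiv_chartMap x hy, hf.2]
  rfl

/-- Smoothness of the coefficients comes from the first fundamental form `⟪∂_u F, ∂_v F⟫` of the
immersion; positivity uses injectivity of the inverse chart's differential. -/
theorem IsIsometricImmersion.isMetricOn (hf : IsIsometricImmersion g f) (x : M) :
    IsMetricOn (chartMetric g x) (extChartAt (𝓡 n) x).target where
  isOpen := isOpen_chartTarget x
  lin y a b u v w := by
    set p := (extChartAt (𝓡 n) x).symm y
    set T : Eu n →L[ℝ] ℝ := (g.inner p (chartSymmDeriv x y w)).comp (chartSymmDeriv x y)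
    have hT : ∀ u, chartMetric g x y u w = T u := fun u => g.symm _ _ _
    rw [hT, hT, hT]
    simp
  symm y u v := g.symm _ _ _
  pos y hy u hu := g.pos _ _ fun h0 =>
    hu (chartSymmDeriv_injective x hy (h0.trans (map_zero _).symm))
  smooth u v := by
    refine ContDiffOn.congr ?_ fun y hy => hf.chartMetric_eq x hy u v
    have hd := fun v => contDiffOn_fderiv_apply (isOpen_chartTarget x) (hf.contDiffOn_chartMap x) v
    exact (hd u).inner ℝ (hd v)

theorem IsIsometricImmersion.ambientDeriv_eq (hf : IsIsometricImmersion g f) (x : M) (v : Eu n) :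
    ambientDeriv f x v = fderiv ℝ (chartMap f x) (extChartAt (𝓡 n) x x) v := by
  rw [hf.fderiv_chartMap x (mem_extChartAt_target x)]
  have h1 : ∀ p : M, p = x → ambientDeriv (n := n) f p v = ambientDeriv f x v := by
    rintro p rfl; rfl
  rw [← h1 _ (extChartAt_to_inv (I := 𝓡 n) x)]
  exact congrArg (fun w : Eu n =>
    ambientDeriv f ((extChartAt (𝓡 n) x).symm (extChartAt (𝓡 n) x x)) w)
    (chartSymmDeriv_self x v).symm

/-- The normal space of a hypersurface of the sphere is spanned by a unit vector. -/
theorem IsIsometricImmersion.exists_unit_normal (hf : IsIsometricImmersion g f) (x : M) :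
    ∃ ξ : EuclideanSpace ℝ (Fin (n + 2)), ‖ξ‖ = 1 ∧ normalSpace f x = Submodule.span ℝ {ξ} := by
  have hG := hf.isMetricOn x
  have hy := mem_extChartAt_target (I := 𝓡 n) x
  set y := extChartAt (𝓡 n) x x with hydef
  have hperp : ∀ v : Eu n, ⟪(f x : EuclideanSpace ℝ (Fin (n + 2))), ambientDeriv f x v⟫ = (0 : ℝ) := by
    intro v
    have h1 := congrArg (fun L => L v) (fderiv_congr_of_eqOn (isOpen_chartTarget x)
      (fun z _ => inner_chartMap_self f x z) hy)
    rw [fderiv_inner_of_contDiffOn (isOpen_chartTarget x) (hf.contDiffOn_chartMap x)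
      (hf.contDiffOn_chartMap x) hy, real_inner_comm (chartMap f x y)] at h1
    simp only [fderiv_fun_const, Pi.zero_apply, _root_.zero_apply] at h1
    rw [hf.ambientDeriv_eq, ← chartMap_self f x]
    linarith
  have hinj : ∀ v : Eu n, ambientDeriv f x v = 0 → v = 0 := by
    intro v hv
    by_contra hne
    have h1 := hG.pos y hy v hne
    rw [hf.chartMetric_eq x hy, ← hf.ambientDeriv_eq, hv, inner_zero_left] at h1
    exact lt_irrefl _ h1
  have hff : ⟪(f x : EuclideanSpace ℝ (Fin (n + 2))), (f x : EuclideanSpace ℝ (Fin (n + 2)))⟫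
      = (1 : ℝ) := by
    rw [← chartMap_self f x]; exact inner_chartMap_self f x _
  set A : Eu n →L[ℝ] EuclideanSpace ℝ (Fin (n + 2)) := ambientDeriv f x with hA
  set W : Submodule ℝ (EuclideanSpace ℝ (Fin (n + 2))) := Submodule.span ℝ
    (insert (f x : EuclideanSpace ℝ (Fin (n + 2))) (Set.range A)) with hW
  -- Injectivity of `(t, v) ↦ t f(x) + df(v)` gives the span dimension `n + 1`, which leaves a line
  -- in `ℝⁿ⁺²` as its complement.
  set L : ℝ × Eu n →ₗ[ℝ] EuclideanSpace ℝ (Fin (n + 2)) :=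
    (LinearMap.toSpanSingleton ℝ _ (f x : EuclideanSpace ℝ (Fin (n + 2)))).coprod
      A.toLinearMap with hL
  have hLapp : ∀ t v, L (t, v) = t • (f x : EuclideanSpace ℝ (Fin (n + 2))) + A v := by
    intro t v; rfl
  have hLinj : Injective L := by
    rw [injective_iff_map_eq_zero]
    rintro ⟨t, v⟩ h0
    rw [hLapp] at h0
    have h1 : (⟪(f x : EuclideanSpace ℝ (Fin (n + 2))), t • (f x : EuclideanSpace ℝ (Fin (n + 2)))
        + A v⟫ : ℝ) = 0 := by rw [h0, inner_zero_right]
    have h2 : ⟪(f x : EuclideanSpace ℝ (Fin (n + 2))), A v⟫ = (0 : ℝ) := hperp v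
    rw [inner_add_right, inner_smul_right, hff, h2] at h1
    have ht : t = 0 := by linarith
    subst ht
    rw [zero_smul, zero_add] at h0
    rw [hinj v h0]; rfl
  have hWL : W = LinearMap.range L := by
    rw [hW, Submodule.span_insert, hL, LinearMap.range_coprod]
    congr 1
    · exact (LinearMap.range_toSpanSingleton _).symm
    · exact Submodule.span_eq (LinearMap.range A.toLinearMap)
  have hfr : Module.finrank ℝ W = n + 1 := by
    rw [hWL, LinearMap.finrank_range_of_inj hLinj]
    simp [add_comm]
  have hfr2 : Module.finrank ℝ Wᗮ = 1 := by
    have := Submodule.finrank_add_finrank_orthogonal W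
    rw [hfr, finrank_euclideanSpace_fin] at this
    omega
  obtain ⟨⟨q, hqW⟩, hq0, hq⟩ := finrank_eq_one_iff'.mp hfr2
  have hqne : q ≠ 0 := fun h => hq0 (by ext1; exact h)
  refine ⟨‖q‖⁻¹ • q, norm_smul_inv_norm hqne, ?_⟩
  rw [Submodule.span_singleton_smul_eq (by simpa using hqne)]
  change Wᗮ = _
  apply le_antisymm
  · intro w hw
    obtain ⟨c, hc⟩ := hq ⟨w, hw⟩
    exact Submodule.mem_span_singleton.mpr ⟨c, congrArg Subtype.val hc⟩
  · rw [Submodule.span_singleton_le_iff_mem]; exact hqW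

theorem secondFundamentalForm_eq {x : M} {ξ : EuclideanSpace ℝ (Fin (n + 2))} (hξ : ‖ξ‖ = 1)
    (hN : normalSpace f x = Submodule.span ℝ {ξ}) (u v : Eu n) :
    secondFundamentalForm f x u v = (⟪ξ, fderiv ℝ (fun z => fderiv ℝ (chartMap f x) z v)
      (extChartAt (𝓡 n) x x) u⟫ : ℝ) • ξ := by
  have h1 : (normalSpace f x).starProjection = (Submodule.span ℝ {ξ}).starProjection := by
    congr!
  have h2 : secondFundamentalForm f x u v = (normalSpace f x).starProjection
      (fderiv ℝ (fun z => fderiv ℝ (chartMap f x) z (chartDeriv (n := n) x v))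
        (extChartAt (𝓡 n) x x) (chartDeriv (n := n) x u)) := rfl
  rw [h2, h1, Submodule.starProjection_unit_singleton ℝ hξ, chartDeriv_apply, chartDeriv_apply]

theorem meanCurvature_eq {x : M} {ξ : EuclideanSpace ℝ (Fin (n + 2))} (hξ : ‖ξ‖ = 1)
    (hN : normalSpace f x = Submodule.span ℝ {ξ}) :
    meanCurvature g f x = |∑ i, ∑ j, invGram (e n) (RiemMetric.at g x) i j *
      ⟪ξ, fderiv ℝ (fun z => fderiv ℝ (chartMap f x) z (e n j))
        (extChartAt (𝓡 n) x x) (e n i)⟫| / n := by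
  have h1 : meanCurvatureVector g f x = ((n : ℝ)⁻¹ * ∑ i, ∑ j,
      invGram (e n) (RiemMetric.at g x) i j *
      ⟪ξ, fderiv ℝ (fun z => fderiv ℝ (chartMap f x) z (e n j))
        (extChartAt (𝓡 n) x x) (e n i)⟫) • ξ := by
    rw [meanCurvatureVector, mul_smul, sum_smul]
    congr 1
    refine sum_congr rfl fun i _ => ?_
    rw [sum_smul]
    refine sum_congr rfl fun j _ => ?_
    rw [mul_smul]
    congr 1
    exact secondFundamentalForm_eq hξ hN (e n i) (e n j)
  rw [meanCurvature, h1, norm_smul, hξ, mul_one, Real.norm_eq_abs, abs_mul, abs_inv,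
    Nat.abs_cast, div_eq_inv_mul]

end Chart

/-! ### Conclusion: the pointwise estimate in the preferred chart. -/

theorem bochnerNonneg_of_pinched {n k : ℕ} (hk : 2 ≤ k) (hkn : 2 * k ≤ n)
    {M : Type*} [TopologicalSpace M] [ChartedSpace (Eu n) M] [IsManifold (𝓡 n) ∞ M]
    {g : RiemMetric n M} {f : M → Metric.sphere (0 : EuclideanSpace ℝ (Fin (n + 2))) 1}
    (hf : IsIsometricImmersion g f) (hpinch : RicciPinched g f k) : BochnerNonneg g k := by
  intro η hη x
  have hG := hf.isMetricOn x
  have hF := hf.contDiffOn_chartMap x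
  have hy := mem_extChartAt_target (I := 𝓡 n) x
  have hT := isFormOn_chartForm hη x
  have hGF : ∀ z ∈ (extChartAt (𝓡 n) x).target, ∀ u v, chartMetric g x z u v
      = ⟪fderiv ℝ (chartMap f x) z u, fderiv ℝ (chartMap f x) z v⟫ :=
    fun z hz u v => hf.chartMetric_eq x hz u v
  set y := extChartAt (𝓡 n) x x with hydef
  obtain ⟨ξ, hξ, hN⟩ := hf.exists_unit_normal x
  have hgat : (RiemMetric.at g x : Eu n → Eu n → ℝ) = chartMetric g x y :=
    funext fun u => funext fun v => (chartMetric_self g x u v).symm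
  set h : Eu n → Eu n → ℝ :=
    fun u v => ⟪ξ, fderiv ℝ (fun z => fderiv ℝ (chartMap f x) z v) y u⟫ with hh
  have hl : ∀ w, IsLinearMap ℝ (fun v => h v w) := fun w => isLinearMap_of_lin fun a b p q => by
    simp only [hh, map_add, map_smul, inner_add_right, inner_smul_right, smul_eq_mul]
  have hs : ∀ v w, h v w = h w v := fun v w => by
    simp only [hh, fderiv_fderiv_comm hG.isOpen hF hy v w]
  have hξmem : ξ ∈ normalSpace f x := by rw [hN]; exact Submodule.mem_span_singleton_self ξ
  have hR : IsGaussCurvature (chartMetric g x y) h (Coord.curvature (chartMetric g x) y) := by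
    refine isGaussCurvature_of_sphere hG hF hGF (fun z _ => inner_chartMap_self f x z) hy ?_ ?_ ?_
    · rw [real_inner_comm, chartMap_self]
      exact hξmem _ (Submodule.subset_span (Set.mem_insert _ _))
    · intro v
      rw [real_inner_comm, ← hf.ambientDeriv_eq]
      exact hξmem _ (Submodule.subset_span (Set.mem_insert_of_mem _ ⟨v, rfl⟩))
    -- Orthogonality to the generators `f x` and `df(v)` puts `q` in the normal line, where
    -- projection onto `ξ` is the identity.
    · intro q hq1 hq2
      have hq : q ∈ normalSpace f x := by
        rw [normalSpace, Submodule.mem_orthogonal]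
        intro p hp
        induction hp using Submodule.span_induction with
        | mem p hp =>
          rcases hp with rfl | ⟨v, rfl⟩
          · rw [← chartMap_self f x]; exact hq1
          · exact (congrArg (fun r => ⟪r, q⟫) (hf.ambientDeriv_eq x v)).trans (hq2 v)
        | zero => exact inner_zero_left _
        | add p p' _ _ h1 h2 => rw [inner_add_left, h1, h2, add_zero]
        | smul c p _ h1 => rw [inner_smul_left, h1, mul_zero]
      rw [hN] at hq
      have := Submodule.starProjection_eq_self_iff.mpr hq
      rw [Submodule.starProjection_unit_singleton ℝ hξ] at this
      exact this.symm
  -- Positive degree selects the branch of the Hodge Laplacian that contains `dδ`.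
  obtain ⟨k, rfl⟩ : ∃ l, k = l + 1 := ⟨k - 1, by omega⟩
  have hB : (bochnerOperator g η x : (Fin (k + 1) → Eu n) → ℝ)
      = weitzenbockTerm (chartMetric g x y) (Coord.curvature (chartMetric g x) y)
        (chartForm η x y) := by
    funext v
    have hv : (fun s => chartDeriv (n := n) x (v s)) = v := funext fun s => chartDeriv_apply x (v s)
    have h1 : bochnerOperator g η x v
        = Coord.hodgeLaplacian (chartMetric g x) (k + 1) (chartForm η x) y
            (fun s => chartDeriv (n := n) x (v s))
          - Coord.roughLaplacian (chartMetric g x) (chartForm η x) y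
            (fun s => chartDeriv (n := n) x (v s)) := rfl
    rw [h1, hv]
    exact hodge_sub_rough hG hT hy (fun u w => hR.isLinear_third hG hy hl hs u w) v
  have hη' : (fun X : Fin (k + 1) → Eu n => η x X) = chartForm η x y :=
    funext fun v => (chartForm_self η x v).symm
  have hfinal := weitzenbockTerm_nonneg hk hkn hR hG hy hl hs (hT.alt y) (fun v hv => by
    have hp := hpinch x v (by rw [← hv]; exact (chartMetric_self g x v v).symm)
    rw [meanCurvature_eq hξ hN] at hp
    have h2 : ricciTensor g x v v
        = ∑ i, (Coord.curvature (chartMetric g x) y (e n i) v v) i := by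
      change Coord.ricci (chartMetric g x) y (chartDeriv (n := n) x v) (chartDeriv (n := n) x v) = _
      rw [chartDeriv_apply]; rfl
    rw [h2] at hp
    rw [← hgat]
    exact hp)
  rw [← hB, ← hη', ← hgat] at hfinal
  exact hfinal

end HypersurfaceBochner

end

theorem mainTheorem5 (n k : ℕ) (hn : 4 ≤ n) (hk : 2 ≤ k) (hkn : 2 * k ≤ n)
    {M : Type*} [TopologicalSpace M] [T2Space M] [CompactSpace M]
    [ChartedSpace (EuclideanSpace ℝ (Fin n)) M] [IsManifold (𝓡 n) ∞ M]
    (g : HypersurfaceBochner.RiemMetric n M)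
    (f : M → Metric.sphere (0 : EuclideanSpace ℝ (Fin (n + 2))) 1)
    (hf : HypersurfaceBochner.IsIsometricImmersion g f)
    (hpinch : HypersurfaceBochner.RicciPinched g f k) :
    HypersurfaceBochner.BochnerNonneg g k :=
  HypersurfaceBochner.bochnerNonneg_of_pinched hk hkn hf hpinch
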